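/- A rational function is said to have no zeros or poles in $\mathbb{N}=\{0,1,2,\dots\}$ if, in lowest terms, neither its numerator nor its denominator vanishes at any $n\in\mathbb{N}$. For $P,Q\in\mathbb{Q}(x)$ without zeros or poles in $\mathbb{N}$, a sequence $f=(f(n))_{n\in\mathbb{N}}$ is $(P,Q)$-holonomic if $f(n+2)=P(n)f(n+1)+Q(n)f(n)$ for all $n\in\mathbb{N}$; its initial value is $(f(0),f(1))$. A sequence $f$ has the ultimate sign $s=(s_0,\dots,s_{\tau-1})\in\{+,-,0\}^{\tau}$ ($\tau\ge 1$) at $N\in\mathbb{N}$ if $\operatorname{sgn} f(n)=s_{n\bmod\tau}$ for all $n\ge N$; it has the ultimate sign $s$ if it does so at some $N$. An ultimate sign $s$ of a $(P,Q)$-holonomic sequence $f$ with initial value $f_0\in\mathbb{Q}^2$ is stable if there is a neighbourhood $\mathcal{N}\subseteq\mathbb{Q}^2$ of $f_0$ such that all $(P,Q)$-holonomic sequences with initial value in $\mathcal{N}$ have the same ultimate sign $s$. Theorem. There exists a partial algorithm (a partial computable function) that, - given $P,Q\in\mathbb{Q}(x)$ without zeros or poles in $\mathbb{N}$ (each given as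 a quotient of two integer-coefficient polynomials, by their lists of coefficients) together with a pair $f_0\in\mathbb{Q}^2$ (each component given as a fraction of integers), - terminates if and only if the $(P,Q)$-holonomic sequence $f$ with initial value $f_0$ has a stable ultimate sign, and - whenever it terminates, outputs an index $N\in\mathbb{N}$ at which $f$ has its stable ultimate sign. -/

import Mathlib

open Polynomial Topology

section Sequences

variable {K : Type*} [Field K]

/-- The rational function `R` has neither zeros nor poles in `ℕ`
(`R.num` and `R.denom` are the coprime numerator and denominator). -/
def NoZerosOrPoles (R : RatFunc K) : Prop :=
  ∀ n : ℕ, R.num.eval (n : K) ≠ 0 ∧ R.denom.eval (n : K) ≠ 0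

/-- The value `R(n)` of a rational function at a natural number (meaningful when `n` is not a
pole of `R`). -/
noncomputable def evalNat (R : RatFunc K) (n : ℕ) : K :=
  R.eval (RingHom.id K) (n : K)

/-- `f` is a `(P, Q)`-holonomic sequence. Its initial value is `(f 0, f 1)`. -/
def IsHolonomic (P Q : RatFunc K) (f : ℕ → K) : Prop :=
  ∀ n : ℕ, f (n + 2) = evalNat P n * f (n + 1) + evalNat Q n * f n

variable [LinearOrder K]

/-- `f` has the ultimate sign `s = (s_0, …, s_{τ-1})`, a nonempty word of signs, at the
index `N`: the sign of `f n` is `s_{n mod τ}` for all `n ≥ N`. -/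
def HasUltimateSignAt (f : ℕ → K) (s : List SignType) (N : ℕ) : Prop :=
  s ≠ [] ∧ ∀ n : ℕ, N ≤ n → s[n % s.length]? = some (SignType.sign (f n))

/-- `f` has the ultimate sign `s` (at some index). -/
def HasUltimateSign (f : ℕ → K) (s : List SignType) : Prop :=
  ∃ N : ℕ, HasUltimateSignAt f s N

end Sequences

/-- `f` has the ultimate sign `s`, and it is stable: there is a neighbourhood in `ℚ²` of the
initial value of `f` such that all `(P, Q)`-holonomic sequences with initial value in this
neighbourhood have the same ultimate sign `s`. -/
def HasStableUltimateSign (P Q : RatFunc ℚ) (f : ℕ → ℚ) (s : List SignType) : Prop :=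
  HasUltimateSign f s ∧
    ∃ U ∈ 𝓝 ((f 0, f 1) : ℚ × ℚ), ∀ g : ℕ → ℚ,
      IsHolonomic P Q g → (g 0, g 1) ∈ U → HasUltimateSign g s

/-- The polynomial with the given list of integer coefficients, constant coefficient first. -/
noncomputable def polyOfList : List ℤ → ℚ[X]
  | [] => 0
  | a :: l => C (a : ℚ) + X * polyOfList l

/-- A pair of coefficient lists `(a, b)` represents the rational function
`(∑ aᵢ xⁱ) / (∑ bᵢ xⁱ)`, provided that the denominator is not the zero polynomial. -/
def RepresentsRatFunc (c : List ℤ × List ℤ) (R : RatFunc ℚ) : Prop :=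
  polyOfList c.2 ≠ 0 ∧
    R = algebraMap ℚ[X] (RatFunc ℚ) (polyOfList c.1) /
      algebraMap ℚ[X] (RatFunc ℚ) (polyOfList c.2)

/-- A pair `(a, b)` with `b ≠ 0` represents the rational number `a / b`. -/
def RepresentsRat (c : ℤ × ℕ) (q : ℚ) : Prop :=
  c.2 ≠ 0 ∧ q = (c.1 : ℚ) / (c.2 : ℚ)

/-- Finite input data of an algorithm: two rational functions, each as a fraction of
polynomials with integer coefficients, and two rational numbers, each as a fraction. -/
abbrev AlgInput : Type :=
  ((List ℤ × List ℤ) × (List ℤ × List ℤ)) × ((ℤ × ℕ) × (ℤ × ℕ))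

/-- The input `c` represents `P`, `Q` and the pair `v`. -/
def AlgInput.Represents (c : AlgInput) (P Q : RatFunc ℚ) (v : ℚ × ℚ) : Prop :=
  RepresentsRatFunc c.1.1 P ∧ RepresentsRatFunc c.1.2 Q ∧
    RepresentsRat c.2.1 v.1 ∧ RepresentsRat c.2.2 v.2

/-! A stable ultimate sign is equivalent to a finite certificate that can be checked. The algorithm
searches through all certificates and returns the index of a valid one.

A certificate consists of a period τ, an index N, a polynomial recurrence representing `P` and `Q`,
and an ultimately positive rational slope L. The cone condition says that f(n+τ) - L(n) f(n) has the
sign of f(n). Polynomial multipliers of fixed sign witness that the condition passes from n to n+τ.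
If it holds strictly at N, ..., N+τ-1, then the signs of f are τ-periodic from N on. Finitely many
strict inequalities define an open set of initial values, so the sign is stable
(`Certificate.Valid.hasStableUltimateSign`). The check is primitive recursive: an integer polynomial
has constant sign beyond the sum of the absolute values of its coefficients, so one evaluation there
decides positivity or vanishing (`IsMaj.sign_eq_sign_leadingCoeff`).

Conversely, stability makes f dominate every rational solution up to a constant
(`HasStableUltimateSign.exists_dominates`). Let τ be twice the length of the sign word. Then f(n+2τ)
= p(n) f(n+τ) - q(n) f(n) with rational functions p and q. If the decimation degenerates to first
order, half of the ratio f(n+τ)/f(n) is a suitable slope. Otherwise p, q > 0 ultimately. Put ρ(n) =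
q(n+τ)/(p(n)p(n+τ)). If ρ exceeded 1/4 + β/n² with β > τ²/16, solutions would oscillate
(`riccati_not_pos`). As ρ is rational, it is therefore at most 1/4 + τ²/(16n²) + O(1/n³), which
makes the cones of slope L(n+τ) = p(n)(1/2 + τ/(4(n-C))) invariant for some constant C. A sequence
that never enters them grows at most like the product of the slopes. A solution starting above the
boundary outgrows that product, because the harmonic series diverges (`not_dominates_of_le_slope`).
So the dominant f enters the cones. -/

/-! ### Primitive recursive integer arithmetic -/

section IntPrimrec

variable {α : Type*} [Primcodable α]

/-- Even codes stand for nonnegative and odd codes for negative integers, so conversions reduce to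
parity and halving. -/
theorem Int.encode_ofNat (n : ℕ) : Encodable.encode (Int.ofNat n) = 2 * n := by
  change Nat.bit false n = _
  simp [Nat.bit_val]

theorem Int.encode_negSucc (n : ℕ) : Encodable.encode (Int.negSucc n) = 2 * n + 1 := by
  change Nat.bit true n = _
  simp [Nat.bit_val]

theorem Primrec.int_natCast : Primrec (fun n : ℕ => (n : ℤ)) :=
  Primrec.encode_iff.1 (Primrec.nat_double.of_eq fun n => (Int.encode_ofNat n).symm)

theorem Primrec.int_negSucc : Primrec Int.negSucc :=
  Primrec.encode_iff.1 (Primrec.nat_double_succ.of_eq fun n => (Int.encode_negSucc n).symm)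

theorem Primrec.int_toNat : Primrec Int.toNat := by
  have h : Primrec fun z : ℤ =>
      if Nat.bodd (Encodable.encode z) = true then 0 else Nat.div2 (Encodable.encode z) :=
    Primrec.ite (Primrec.eq.comp (Primrec.nat_bodd.comp Primrec.encode) (Primrec.const true))
      (Primrec.const 0) (Primrec.nat_div2.comp Primrec.encode)
  refine h.of_eq fun z => ?_
  cases z with
  | ofNat n =>
    rw [Int.encode_ofNat]; simp [Nat.div2_val]
  | negSucc n =>
    rw [Int.encode_negSucc]; simp

/-- Sums, differences and products of integers are differences of natural numbers built from
positive and negative parts, so this one subtraction covers them all. -/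
theorem Primrec.int_natSub {f g : α → ℕ} (hf : Primrec f) (hg : Primrec g) :
    Primrec fun x => (f x : ℤ) - g x := by
  have h : Primrec fun x => if g x ≤ f x then ((f x - g x : ℕ) : ℤ)
      else Int.negSucc (g x - f x - 1) :=
    Primrec.ite (Primrec.nat_le.comp hg hf)
      (Primrec.int_natCast.comp (Primrec.nat_sub.comp hf hg))
      (Primrec.int_negSucc.comp
        (Primrec.nat_sub.comp (Primrec.nat_sub.comp hg hf) (Primrec.const 1)))
  refine h.of_eq fun x => ?_
  split_ifs <;> omega

theorem Primrec.int_toNat_neg : Primrec fun z : ℤ => (-z).toNat := by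
  have h : Primrec fun z : ℤ =>
      if Nat.bodd (Encodable.encode z) = true then Nat.div2 (Encodable.encode z) + 1 else 0 :=
    Primrec.ite (Primrec.eq.comp (Primrec.nat_bodd.comp Primrec.encode) (Primrec.const true))
      (Primrec.succ.comp (Primrec.nat_div2.comp Primrec.encode)) (Primrec.const 0)
  refine h.of_eq fun z => ?_
  cases z with
  | ofNat n =>
    rw [Int.encode_ofNat]; simp
  | negSucc n =>
    rw [Int.encode_negSucc]
    simp [Nat.div2_val]

theorem Primrec.int_add {f g : α → ℤ} (hf : Primrec f) (hg : Primrec g) :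
    Primrec fun x => f x + g x :=
  (Primrec.int_natSub
    (Primrec.nat_add.comp (Primrec.int_toNat.comp hf) (Primrec.int_toNat.comp hg))
    (Primrec.nat_add.comp (Primrec.int_toNat_neg.comp hf) (Primrec.int_toNat_neg.comp hg))).of_eq
    fun x => by omega

theorem Primrec.int_sub {f g : α → ℤ} (hf : Primrec f) (hg : Primrec g) :
    Primrec fun x => f x - g x :=
  (Primrec.int_natSub
    (Primrec.nat_add.comp (Primrec.int_toNat.comp hf) (Primrec.int_toNat_neg.comp hg))
    (Primrec.nat_add.comp (Primrec.int_toNat_neg.comp hf) (Primrec.int_toNat.comp hg))).of_eq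
    fun x => by omega

theorem Primrec.int_abs {f : α → ℤ} (hf : Primrec f) : Primrec fun x => |f x| :=
  (Primrec.int_natCast.comp
    (Primrec.nat_add.comp (Primrec.int_toNat.comp hf) (Primrec.int_toNat_neg.comp hf))).of_eq
    fun x => by
      rcases abs_cases (f x) with ⟨h, _⟩ | ⟨h, _⟩ <;> rw [h] <;> omega

theorem Primrec.int_mul {f g : α → ℤ} (hf : Primrec f) (hg : Primrec g) :
    Primrec fun x => f x * g x :=
  (Primrec.int_natSub
    (Primrec.nat_add.comp
      (Primrec.nat_mul.comp (Primrec.int_toNat.comp hf) (Primrec.int_toNat.comp hg))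
      (Primrec.nat_mul.comp (Primrec.int_toNat_neg.comp hf) (Primrec.int_toNat_neg.comp hg)))
    (Primrec.nat_add.comp
      (Primrec.nat_mul.comp (Primrec.int_toNat.comp hf) (Primrec.int_toNat_neg.comp hg))
      (Primrec.nat_mul.comp (Primrec.int_toNat_neg.comp hf) (Primrec.int_toNat.comp hg)))).of_eq
    fun x => by
      have h1 : f x = (f x).toNat - (-f x).toNat := by omega
      have h2 : g x = (g x).toNat - (-g x).toNat := by omega
      conv_rhs => rw [h1, h2]
      push_cast
      ring

theorem Primrec.int_le {f g : α → ℤ} (hf : Primrec f) (hg : Primrec g) :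
    PrimrecPred fun x => f x ≤ g x :=
  (Primrec.eq.comp (Primrec.int_toNat.comp (Primrec.int_sub hf hg)) (Primrec.const 0)).of_eq
    fun x => by omega

theorem Primrec.int_lt {f g : α → ℤ} (hf : Primrec f) (hg : Primrec g) :
    PrimrecPred fun x => f x < g x :=
  (Primrec.int_le hg hf).not.of_eq fun x => by omega

end IntPrimrec

/-! ### Polynomials as coefficient lists -/

section ListEval

/-- The value at `n` of the polynomial with the given coefficient list. -/
def listEval (l : List ℤ) (n : ℕ) : ℤ := l.foldr (fun a s => a + n * s) 0

/-- The list of absolute values. -/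
def absList (l : List ℤ) : List ℤ := l.map fun a => |a|

variable {α : Type*} [Primcodable α]

theorem Primrec.listEval {f : α → List ℤ} {g : α → ℕ} (hf : Primrec f) (hg : Primrec g) :
    Primrec fun x => listEval (f x) (g x) := by
  have h : Primrec fun x => (f x).foldr (fun a s => a + (g x : ℤ) * s) 0 :=
    Primrec.list_foldr (h := fun x p => p.1 + (g x : ℤ) * p.2) hf (Primrec.const 0)
      (Primrec₂.mk (Primrec.int_add (Primrec.fst.comp Primrec.snd)
        (Primrec.int_mul (Primrec.int_natCast.comp (hg.comp Primrec.fst))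
          (Primrec.snd.comp Primrec.snd))))
  exact h

theorem Primrec.absList {f : α → List ℤ} (hf : Primrec f) : Primrec fun x => absList (f x) :=
  Primrec.list_map hf (Primrec₂.mk (Primrec.int_abs Primrec.snd))

end ListEval

/-! ### Certificates and their validity -/

section Certificates

/-- Coefficient lists `(α, β, γ)` of the recurrence `α(n) f(n+2) = β(n) f(n+1) + γ(n) f(n)`. -/
abbrev RecData : Type := List ℤ × List ℤ × List ℤ

/-- The leading coefficient `α` of the recurrence. -/
def RecData.lead (A : RecData) : List ℤ := A.1
/-- The coefficient `β` of the recurrence. -/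
def RecData.mid (A : RecData) : List ℤ := A.2.1
/-- The coefficient `γ` of the recurrence. -/
def RecData.low (A : RecData) : List ℤ := A.2.2

/-- One step of the recurrence at index `m`, with denominators collected in the last entry. -/
def runStep (A : RecData) (m : ℕ) (v : ℤ × ℤ × ℤ) : ℤ × ℤ × ℤ :=
  (listEval A.lead m * v.2.1, listEval A.low m * v.1 + listEval A.mid m * v.2.1,
    listEval A.lead m * v.2.2)

/-- `k` steps of the recurrence, starting at index `n`. -/
def run (A : RecData) (n k : ℕ) (v : ℤ × ℤ × ℤ) : ℤ × ℤ × ℤ :=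
  Nat.rec v (fun i w => runStep A (n + i) w) k

/-- Data certifying that a solution of a recurrence enters an invariant family of cones: the
recurrence, two polynomials whose quotient is the slope of the cone, three polynomials expressing
the invariance, the period, and the index from which on everything is valid. -/
abbrev Certificate : Type :=
  (RecData × (List ℤ × List ℤ)) × ((List ℤ × List ℤ × List ℤ) × (ℕ × ℕ))

namespace Certificate

variable (k : Certificate)

/-- The recurrence. -/
def recData : RecData := k.1.1
/-- The numerator of the slope of the cone. -/
def slopeNum : List ℤ := k.1.2.1
/-- The denominator of the slope of the cone. -/
def slopeDen : List ℤ := k.1.2.2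
/-- The multiplier of the distance to the boundary of the cone. -/
def mulCone : List ℤ := k.2.1.1
/-- The multiplier of the current value. -/
def mulBase : List ℤ := k.2.1.2.1
/-- The multiplier of the distance to the boundary of the next cone. -/
def mulNext : List ℤ := k.2.1.2.2
/-- The period of the sign pattern. -/
def period : ℕ := k.2.2.1
/-- The index from which on the certificate is valid. -/
def index : ℕ := k.2.2.2

/-- One side of the identity that expresses the invariance of the cones. -/
def lhs (v : ℤ × ℤ × ℤ) (n : ℕ) : ℤ :=
  listEval k.mulNext n * listEval k.slopeDen (n + k.period) *
      (run k.recData n (2 * k.period) v).1 +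
    listEval k.mulCone n * listEval k.slopeNum n * (run k.recData n (2 * k.period) v).2.2 * v.1

/-- The other side of the identity that expresses the invariance of the cones. -/
def rhs (v : ℤ × ℤ × ℤ) (n : ℕ) : ℤ :=
  (listEval k.mulNext n * listEval k.slopeNum (n + k.period) +
      listEval k.mulCone n * listEval k.slopeDen n) *
      (run k.recData n k.period v).1 * (run k.recData (n + k.period) k.period v).2.2 +
    listEval k.mulBase n * (run k.recData n (2 * k.period) v).2.2 * v.1

/-- The certificate with all coefficients replaced by their absolute values. -/
def abs : Certificate :=
  (((absList k.recData.lead, absList k.recData.mid, absList k.recData.low),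
    (absList k.slopeNum, absList k.slopeDen)),
    ((absList k.mulCone, absList k.mulBase, absList k.mulNext), (k.period, k.index)))

/-- The value at `k.index` of the polynomial `l` is positive and determines its sign beyond. -/
def IsPos (l : List ℤ) : Prop := listEval (absList l) 1 ≤ k.index ∧ 0 < listEval l k.index

/-- The value at `k.index` of the polynomial `l` is nonnegative and determines its sign beyond. -/
def IsNonneg (l : List ℤ) : Prop := listEval (absList l) 1 ≤ k.index ∧ 0 ≤ listEval l k.index

/-- The index is large enough to test the identity `α a = β b` of polynomials there. -/
def IsProp (α a β b : List ℤ) : Prop :=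
  listEval (absList α) 1 * listEval (absList a) 1 +
      listEval (absList β) 1 * listEval (absList b) 1 ≤ k.index ∧
    listEval α k.index * listEval a k.index = listEval β k.index * listEval b k.index

/-- The index is large enough to test the identity `k.lhs v = k.rhs v` there. -/
def IsInvariant (v : ℤ × ℤ × ℤ) : Prop :=
  k.abs.lhs v 1 + k.abs.rhs v 1 ≤ k.index ∧ k.lhs v k.index = k.rhs v k.index

/-- The solution with the given initial state lies in the cone at index `n`. -/
def InCone (v : ℤ × ℤ × ℤ) (n : ℕ) : Prop :=
  0 < (listEval k.slopeDen n * (run k.recData 0 (n + k.period) v).1 -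
    listEval k.slopeNum n * (run k.recData n k.period (1, 0, 1)).2.2 *
      (run k.recData 0 n v).1) * (run k.recData 0 n v).1

end Certificate

/-- The initial state, with denominators cleared. -/
def AlgInput.init (c : AlgInput) : ℤ × ℤ × ℤ :=
  (c.2.1.1 * c.2.2.2, c.2.2.1 * c.2.1.2, c.2.1.2 * c.2.2.2)

/-- The certificate is valid for the given input. -/
def Certificate.Valid (c : AlgInput) (k : Certificate) : Prop :=
  ((0 < k.period ∧ 0 < k.index) ∧
    (k.IsProp k.recData.lead c.1.1.1 k.recData.mid c.1.1.2 ∧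
      k.IsProp k.recData.lead c.1.2.1 k.recData.low c.1.2.2)) ∧
  (k.IsPos k.recData.lead ∧
    (k.IsPos k.slopeNum ∧ k.IsPos k.slopeDen)) ∧
  ((k.IsNonneg k.mulCone ∧ k.IsNonneg k.mulBase) ∧ k.IsPos k.mulNext) ∧
  (k.IsInvariant (1, 0, 1) ∧ k.IsInvariant (0, 1, 1)) ∧
  ∀ i ∈ List.range k.period, k.InCone c.init (k.index + i)

end Certificates

/-! ### Computability of the check and of the search -/

section CertificatePrimrec

variable {α : Type*} [Primcodable α]

theorem Primrec.nat_add_apply {f g : α → ℕ} (hf : Primrec f) (hg : Primrec g) :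
    Primrec fun x => f x + g x := Primrec.nat_add.comp hf hg

theorem Primrec.nat_mul_apply {f g : α → ℕ} (hf : Primrec f) (hg : Primrec g) :
    Primrec fun x => f x * g x := Primrec.nat_mul.comp hf hg

theorem Primrec.int_natCast_apply {f : α → ℕ} (hf : Primrec f) :
    Primrec fun x => (f x : ℤ) := Primrec.int_natCast.comp hf

namespace RecData

theorem primrec_lead {A : α → RecData} (hA : Primrec A) : Primrec fun x => (A x).lead :=
  Primrec.fst.comp hA

theorem primrec_mid {A : α → RecData} (hA : Primrec A) : Primrec fun x => (A x).mid :=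
  Primrec.fst.comp (Primrec.snd.comp hA)

theorem primrec_low {A : α → RecData} (hA : Primrec A) : Primrec fun x => (A x).low :=
  Primrec.snd.comp (Primrec.snd.comp hA)

end RecData

theorem Primrec.runStep {A : α → RecData} {m : α → ℕ} {v : α → ℤ × ℤ × ℤ} (hA : Primrec A)
    (hm : Primrec m) (hv : Primrec v) : Primrec fun x => runStep (A x) (m x) (v x) := by
  have h1 : Primrec fun x => (v x).1 := Primrec.fst.comp hv
  have h2 : Primrec fun x => (v x).2.1 := Primrec.fst.comp (Primrec.snd.comp hv)
  have h3 : Primrec fun x => (v x).2.2 := Primrec.snd.comp (Primrec.snd.comp hv)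
  have ha := Primrec.listEval (RecData.primrec_lead hA) hm
  have hb := Primrec.listEval (RecData.primrec_mid hA) hm
  have hc := Primrec.listEval (RecData.primrec_low hA) hm
  exact Primrec.pair (Primrec.int_mul ha h2)
    (Primrec.pair (Primrec.int_add (Primrec.int_mul hc h1) (Primrec.int_mul hb h2))
      (Primrec.int_mul ha h3))

theorem Primrec.run {A : α → RecData} {n k : α → ℕ} {v : α → ℤ × ℤ × ℤ} (hA : Primrec A)
    (hn : Primrec n) (hk : Primrec k) (hv : Primrec v) :
    Primrec fun x => run (A x) (n x) (k x) (v x) :=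
  Primrec.nat_rec' (h := fun x p => _root_.runStep (A x) (n x + p.1) p.2) hk hv
    (Primrec₂.mk (Primrec.runStep (hA.comp Primrec.fst)
      (Primrec.nat_add_apply (hn.comp Primrec.fst) (Primrec.fst.comp Primrec.snd))
      (Primrec.snd.comp Primrec.snd)))

theorem Primrec.run_fst {A : α → RecData} {n k : α → ℕ} {v : α → ℤ × ℤ × ℤ} (hA : Primrec A)
    (hn : Primrec n) (hk : Primrec k) (hv : Primrec v) :
    Primrec fun x => (_root_.run (A x) (n x) (k x) (v x)).1 :=
  Primrec.fst.comp (Primrec.run hA hn hk hv)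

theorem Primrec.run_snd_snd {A : α → RecData} {n k : α → ℕ} {v : α → ℤ × ℤ × ℤ} (hA : Primrec A)
    (hn : Primrec n) (hk : Primrec k) (hv : Primrec v) :
    Primrec fun x => (_root_.run (A x) (n x) (k x) (v x)).2.2 :=
  Primrec.snd.comp (Primrec.snd.comp (Primrec.run hA hn hk hv))

theorem PrimrecPred.and_apply {p q : α → Prop} (hp : PrimrecPred p) (hq : PrimrecPred q) :
    PrimrecPred fun x => p x ∧ q x := hp.and hq

theorem PrimrecPred.int_eq {f g : α → ℤ} (hf : Primrec f) (hg : Primrec g) :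
    PrimrecPred fun x => f x = g x := Primrec.eq.comp hf hg

theorem PrimrecPred.nat_lt {f g : α → ℕ} (hf : Primrec f) (hg : Primrec g) :
    PrimrecPred fun x => f x < g x := Primrec.nat_lt.comp hf hg

namespace Certificate

variable {k : α → Certificate} {v : α → ℤ × ℤ × ℤ} {n : α → ℕ} {l a b d : α → List ℤ}

theorem primrec_recData (hk : Primrec k) : Primrec fun x => (k x).recData :=
  Primrec.fst.comp (Primrec.fst.comp hk)

theorem primrec_slopeNum (hk : Primrec k) : Primrec fun x => (k x).slopeNum :=
  Primrec.fst.comp (Primrec.snd.comp (Primrec.fst.comp hk))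

theorem primrec_slopeDen (hk : Primrec k) : Primrec fun x => (k x).slopeDen :=
  Primrec.snd.comp (Primrec.snd.comp (Primrec.fst.comp hk))

theorem primrec_mulCone (hk : Primrec k) : Primrec fun x => (k x).mulCone :=
  Primrec.fst.comp (Primrec.fst.comp (Primrec.snd.comp hk))

theorem primrec_mulBase (hk : Primrec k) : Primrec fun x => (k x).mulBase :=
  Primrec.fst.comp (Primrec.snd.comp (Primrec.fst.comp (Primrec.snd.comp hk)))

theorem primrec_mulNext (hk : Primrec k) : Primrec fun x => (k x).mulNext :=
  Primrec.snd.comp (Primrec.snd.comp (Primrec.fst.comp (Primrec.snd.comp hk)))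

theorem primrec_period (hk : Primrec k) : Primrec fun x => (k x).period :=
  Primrec.fst.comp (Primrec.snd.comp (Primrec.snd.comp hk))

theorem primrec_index (hk : Primrec k) : Primrec fun x => (k x).index :=
  Primrec.snd.comp (Primrec.snd.comp (Primrec.snd.comp hk))

theorem primrec_lhs (hk : Primrec k) (hn : Primrec n) (v : ℤ × ℤ × ℤ) :
    Primrec fun x => (k x).lhs v (n x) := by
  have h0 := primrec_recData hk
  have h1 := Primrec.nat_mul_apply (Primrec.const 2) (primrec_period hk)
  have hr := Primrec.run_fst h0 hn h1 (Primrec.const v)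
  have hd := Primrec.run_snd_snd h0 hn h1 (Primrec.const v)
  have hx := Primrec.nat_add_apply hn (primrec_period hk)
  exact Primrec.int_add (Primrec.int_mul (Primrec.int_mul
      (Primrec.listEval (primrec_mulNext hk) hn) (Primrec.listEval (primrec_slopeDen hk) hx)) hr)
    (Primrec.int_mul (Primrec.int_mul (Primrec.int_mul
      (Primrec.listEval (primrec_mulCone hk) hn) (Primrec.listEval (primrec_slopeNum hk) hn)) hd)
      (Primrec.const v.1))

theorem primrec_rhs (hk : Primrec k) (hn : Primrec n) (v : ℤ × ℤ × ℤ) :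
    Primrec fun x => (k x).rhs v (n x) := by
  have h0 := primrec_recData hk
  have hp := primrec_period hk
  have h1 := Primrec.nat_mul_apply (Primrec.const 2) hp
  have hx := Primrec.nat_add_apply hn hp
  exact Primrec.int_add
    (Primrec.int_mul (Primrec.int_mul (Primrec.int_add
      (Primrec.int_mul (Primrec.listEval (primrec_mulNext hk) hn)
        (Primrec.listEval (primrec_slopeNum hk) hx))
      (Primrec.int_mul (Primrec.listEval (primrec_mulCone hk) hn)
        (Primrec.listEval (primrec_slopeDen hk) hn)))
      (Primrec.run_fst h0 hn hp (Primrec.const v)))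
      (Primrec.run_snd_snd h0 hx hp (Primrec.const v)))
    (Primrec.int_mul (Primrec.int_mul (Primrec.listEval (primrec_mulBase hk) hn)
      (Primrec.run_snd_snd h0 hn h1 (Primrec.const v))) (Primrec.const v.1))

theorem primrec_abs (hk : Primrec k) : Primrec fun x => (k x).abs :=
  Primrec.pair
    (Primrec.pair
      (Primrec.pair (Primrec.absList (RecData.primrec_lead (primrec_recData hk)))
        (Primrec.pair (Primrec.absList (RecData.primrec_mid (primrec_recData hk)))
          (Primrec.absList (RecData.primrec_low (primrec_recData hk)))))
      (Primrec.pair (Primrec.absList (primrec_slopeNum hk))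
        (Primrec.absList (primrec_slopeDen hk))))
    (Primrec.pair
      (Primrec.pair (Primrec.absList (primrec_mulCone hk))
        (Primrec.pair (Primrec.absList (primrec_mulBase hk))
          (Primrec.absList (primrec_mulNext hk))))
      (Primrec.pair (primrec_period hk) (primrec_index hk)))

theorem primrecPred_isPos (hk : Primrec k) (hl : Primrec l) :
    PrimrecPred fun x => (k x).IsPos (l x) :=
  PrimrecPred.and_apply
    (Primrec.int_le (Primrec.listEval (Primrec.absList hl) (Primrec.const 1))
      (Primrec.int_natCast_apply (primrec_index hk)))
    (Primrec.int_lt (Primrec.const 0) (Primrec.listEval hl (primrec_index hk)))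

theorem primrecPred_isNonneg (hk : Primrec k) (hl : Primrec l) :
    PrimrecPred fun x => (k x).IsNonneg (l x) :=
  PrimrecPred.and_apply
    (Primrec.int_le (Primrec.listEval (Primrec.absList hl) (Primrec.const 1))
      (Primrec.int_natCast_apply (primrec_index hk)))
    (Primrec.int_le (Primrec.const 0) (Primrec.listEval hl (primrec_index hk)))

theorem primrecPred_isProp (hk : Primrec k) (hl : Primrec l) (ha : Primrec a) (hb : Primrec b)
    (hd : Primrec d) : PrimrecPred fun x => (k x).IsProp (l x) (a x) (b x) (d x) := by
  have hi := primrec_index hk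
  have h1 : ∀ {l : α → List ℤ}, Primrec l → Primrec fun x => listEval (absList (l x)) 1 :=
    fun hl => Primrec.listEval (Primrec.absList hl) (Primrec.const 1)
  exact PrimrecPred.and_apply
    (Primrec.int_le (Primrec.int_add (Primrec.int_mul (h1 hl) (h1 ha))
      (Primrec.int_mul (h1 hb) (h1 hd))) (Primrec.int_natCast_apply hi))
    (PrimrecPred.int_eq (Primrec.int_mul (Primrec.listEval hl hi) (Primrec.listEval ha hi))
      (Primrec.int_mul (Primrec.listEval hb hi) (Primrec.listEval hd hi)))

theorem primrecPred_isInvariant (hk : Primrec k) (v : ℤ × ℤ × ℤ) :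
    PrimrecPred fun x => (k x).IsInvariant v :=
  PrimrecPred.and_apply
    (Primrec.int_le (Primrec.int_add (primrec_lhs (primrec_abs hk) (Primrec.const 1) v)
      (primrec_rhs (primrec_abs hk) (Primrec.const 1) v))
      (Primrec.int_natCast_apply (primrec_index hk)))
    (PrimrecPred.int_eq (primrec_lhs hk (primrec_index hk) v)
      (primrec_rhs hk (primrec_index hk) v))

theorem primrecPred_inCone (hk : Primrec k) (hv : Primrec v) (hn : Primrec n) :
    PrimrecPred fun x => (k x).InCone (v x) (n x) := by
  have h0 := primrec_recData hk
  have hp := primrec_period hk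
  have hx := Primrec.run_fst h0 (Primrec.const 0) hn hv
  exact Primrec.int_lt (Primrec.const 0) (Primrec.int_mul (Primrec.int_sub
    (Primrec.int_mul (Primrec.listEval (primrec_slopeDen hk) hn)
      (Primrec.run_fst h0 (Primrec.const 0) (Primrec.nat_add_apply hn hp) hv))
    (Primrec.int_mul (Primrec.int_mul (Primrec.listEval (primrec_slopeNum hk) hn)
      (Primrec.run_snd_snd h0 hn hp (Primrec.const (1, 0, 1)))) hx)) hx)

end Certificate

theorem AlgInput.primrec_init : Primrec AlgInput.init := by
  have h1 : Primrec fun c : AlgInput => c.2.1 := Primrec.fst.comp Primrec.snd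
  have h2 : Primrec fun c : AlgInput => c.2.2 := Primrec.snd.comp Primrec.snd
  have h3 : Primrec fun c : AlgInput => c.2.1.1 := Primrec.fst.comp h1
  have h4 : Primrec fun c : AlgInput => (c.2.1.2 : ℤ) :=
    Primrec.int_natCast_apply (Primrec.snd.comp h1)
  have h5 : Primrec fun c : AlgInput => c.2.2.1 := Primrec.fst.comp h2
  have h6 : Primrec fun c : AlgInput => (c.2.2.2 : ℤ) :=
    Primrec.int_natCast_apply (Primrec.snd.comp h2)
  exact Primrec.pair (Primrec.int_mul h3 h6) (Primrec.pair (Primrec.int_mul h5 h4)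
    (Primrec.int_mul h4 h6))

/-- Every condition is an evaluation at explicit points, and the only quantifier is bounded by the
period. -/
theorem Certificate.primrecPred_valid {c : α → AlgInput} {k : α → Certificate}
    (hc : Primrec c) (hk : Primrec k) : PrimrecPred fun x => (k x).Valid (c x) := by
  have hi : Primrec fun x => (c x).init := AlgInput.primrec_init.comp hc
  have hp := Certificate.primrec_period hk
  have hn := Certificate.primrec_index hk
  have hA := Certificate.primrec_recData hk
  have hc1 : Primrec fun x => (c x).1 := Primrec.fst.comp hc
  have hP : Primrec fun x => (c x).1.1 := Primrec.fst.comp hc1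
  have hQ : Primrec fun x => (c x).1.2 := Primrec.snd.comp hc1
  have h : PrimrecRel fun (i : ℕ) (x : α) => (k x).InCone (c x).init ((k x).index + i) :=
    Certificate.primrecPred_inCone (k := fun y : ℕ × α => k y.2) (hk.comp Primrec.snd)
      (hi.comp Primrec.snd) (Primrec.nat_add_apply (hn.comp Primrec.snd) Primrec.fst)
  have h2 : PrimrecPred fun x =>
      ∀ i ∈ List.range (k x).period, (k x).InCone (c x).init ((k x).index + i) :=
    h.forall_mem_list.comp (Primrec.list_range.comp hp) Primrec.id
  have hlead := RecData.primrec_lead hA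
  refine PrimrecPred.and_apply (PrimrecPred.and_apply
    (PrimrecPred.and_apply (PrimrecPred.nat_lt (Primrec.const 0) hp)
      (PrimrecPred.nat_lt (Primrec.const 0) hn)) (PrimrecPred.and_apply
        (Certificate.primrecPred_isProp hk hlead (Primrec.fst.comp hP)
          (RecData.primrec_mid hA) (Primrec.snd.comp hP))
        (Certificate.primrecPred_isProp hk hlead (Primrec.fst.comp hQ)
          (RecData.primrec_low hA) (Primrec.snd.comp hQ)))) ?_
  refine PrimrecPred.and_apply (PrimrecPred.and_apply
    (Certificate.primrecPred_isPos hk hlead)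
    (PrimrecPred.and_apply (Certificate.primrecPred_isPos hk (Certificate.primrec_slopeNum hk))
      (Certificate.primrecPred_isPos hk (Certificate.primrec_slopeDen hk)))) ?_
  refine PrimrecPred.and_apply (PrimrecPred.and_apply (PrimrecPred.and_apply
    (Certificate.primrecPred_isNonneg hk (Certificate.primrec_mulCone hk))
    (Certificate.primrecPred_isNonneg hk (Certificate.primrec_mulBase hk)))
    (Certificate.primrecPred_isPos hk (Certificate.primrec_mulNext hk))) ?_
  exact PrimrecPred.and_apply (PrimrecPred.and_apply
    (Certificate.primrecPred_isInvariant hk (1, 0, 1))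
    (Certificate.primrecPred_isInvariant hk (0, 1, 1))) h2

open Classical in
/-- The index of the certificate with code `i`, if it is valid. -/
noncomputable def tryCertificate (c : AlgInput) (i : ℕ) : Option ℕ :=
  (Encodable.decode (α := Certificate) i).bind fun k =>
    if k.Valid c then some k.index else none

theorem primrec_tryCertificate : Primrec fun y : AlgInput × ℕ => tryCertificate y.1 y.2 := by
  classical
  have hk : Primrec fun y : (AlgInput × ℕ) × Certificate => y.2 := Primrec.snd
  have hc : Primrec fun y : (AlgInput × ℕ) × Certificate => y.1.1 :=
    Primrec.fst.comp Primrec.fst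
  have hg : Primrec₂ fun (y : AlgInput × ℕ) (k : Certificate) =>
      if k.Valid y.1 then some k.index else none :=
    Primrec₂.mk (Primrec.ite (Certificate.primrecPred_valid hc hk)
      (Primrec.option_some.comp (Certificate.primrec_index hk)) (Primrec.const none))
  have hd : Primrec fun y : AlgInput × ℕ => (Encodable.decode y.2 : Option Certificate) :=
    Primrec.comp Primrec.decode Primrec.snd
  exact (Primrec.option_bind hd hg).of_eq fun y => by
    rw [tryCertificate]

/-- The search for a valid certificate. -/
noncomputable def searchCertificate (c : AlgInput) : Part ℕ := Nat.rfindOpt (tryCertificate c)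

theorem partrec_searchCertificate : Partrec searchCertificate := by
  have h1 : Computable fun y : AlgInput × ℕ => tryCertificate y.1 y.2 :=
    primrec_tryCertificate.to_comp
  have h : Computable₂ tryCertificate := h1
  exact Partrec.rfindOpt h

theorem mem_searchCertificate {c : AlgInput} {N : ℕ} (h : N ∈ searchCertificate c) :
    ∃ k : Certificate, k.Valid c ∧ k.index = N := by
  obtain ⟨i, hi⟩ := Nat.rfindOpt_spec h
  rw [Option.mem_def, tryCertificate, Option.bind_eq_some_iff] at hi
  obtain ⟨k, -, hk⟩ := hi
  split_ifs at hk with hv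
  exact ⟨k, hv, Option.some.inj hk⟩

theorem searchCertificate_dom {c : AlgInput} {k : Certificate} (h : k.Valid c) :
    (searchCertificate c).Dom := by
  refine Nat.rfindOpt_dom.2 ⟨Encodable.encode k, k.index, ?_⟩
  rw [tryCertificate, Encodable.encodek, Option.bind_some, if_pos h]
  rfl

end CertificatePrimrec

/-! ### Signs of integer polynomials from a single evaluation -/

section Majorants

/-- `E` is a polynomial function with integer coefficients, bounded in absolute value by those of
a polynomial with value `F` at `1`. -/
def IsMaj (E : ℕ → ℤ) (F : ℤ) : Prop :=
  ∃ p q : ℤ[X], (∀ i, |p.coeff i| ≤ q.coeff i) ∧ (∀ n : ℕ, E n = p.eval (n : ℤ)) ∧ q.eval 1 = F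

namespace IsMaj

variable {E E' : ℕ → ℤ} {F F' : ℤ}

theorem const {a : ℤ} (ha : 0 ≤ a) : IsMaj (fun _ => a) a := by
  refine ⟨C a, C a, fun i => ?_, fun n => by simp, by simp⟩
  rw [coeff_C]
  split_ifs <;> simp [abs_of_nonneg ha]

theorem const_abs (a : ℤ) : IsMaj (fun _ => a) |a| := by
  refine ⟨C a, C |a|, fun i => ?_, fun n => by simp, by simp⟩
  rw [coeff_C, coeff_C]
  split_ifs <;> simp

theorem natCast_add (j : ℕ) : IsMaj (fun n => ((n + j : ℕ) : ℤ)) ((1 + j : ℕ) : ℤ) := by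
  refine ⟨X + C (j : ℤ), X + C (j : ℤ), fun i => le_of_eq (abs_of_nonneg ?_), fun n => by simp,
    by simp⟩
  rw [coeff_add, coeff_X, coeff_C]
  split_ifs <;> positivity

theorem add (h : IsMaj E F) (h' : IsMaj E' F') : IsMaj (fun n => E n + E' n) (F + F') := by
  obtain ⟨p, q, hpq, hp, hq⟩ := h
  obtain ⟨p', q', hpq', hp', hq'⟩ := h'
  refine ⟨p + p', q + q', fun i => ?_, fun n => by simp [hp, hp'], by simp [hq, hq']⟩
  rw [coeff_add, coeff_add]
  exact (abs_add_le _ _).trans (add_le_add (hpq i) (hpq' i))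

theorem sub (h : IsMaj E F) (h' : IsMaj E' F') : IsMaj (fun n => E n - E' n) (F + F') := by
  obtain ⟨p, q, hpq, hp, hq⟩ := h
  obtain ⟨p', q', hpq', hp', hq'⟩ := h'
  refine ⟨p - p', q + q', fun i => ?_, fun n => by simp [hp, hp'], by simp [hq, hq']⟩
  rw [coeff_sub, coeff_add]
  exact (abs_sub _ _).trans (add_le_add (hpq i) (hpq' i))

theorem mul (h : IsMaj E F) (h' : IsMaj E' F') : IsMaj (fun n => E n * E' n) (F * F') := by
  obtain ⟨p, q, hpq, hp, hq⟩ := h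
  obtain ⟨p', q', hpq', hp', hq'⟩ := h'
  refine ⟨p * p', q * q', fun i => ?_, fun n => by simp [hp, hp'], by simp [hq, hq']⟩
  rw [coeff_mul, coeff_mul]
  refine (Finset.abs_sum_le_sum_abs _ _).trans (Finset.sum_le_sum fun x _ => ?_)
  rw [abs_mul]
  exact mul_le_mul (hpq _) (hpq' _) (abs_nonneg _) ((abs_nonneg _).trans (hpq _))

/-- Horner's scheme uses only sums and products, which majorants respect. The majorant at 1 is the
same scheme with absolute coefficients, read at n = 1. -/
theorem listEval (l : List ℤ) (j : ℕ) :
    IsMaj (fun n => listEval l (n + j)) (listEval (absList l) (1 + j)) := by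
  induction l with
  | nil => exact const le_rfl
  | cons a l ih => exact (const_abs a).add ((natCast_add j).mul ih)

theorem run (A : RecData) (j k : ℕ) {v : ℤ × ℤ × ℤ} (h1 : 0 ≤ v.1) (h2 : 0 ≤ v.2.1)
    (h3 : 0 ≤ v.2.2) :
    IsMaj (fun n => (run A (n + j) k v).1)
      (_root_.run (absList A.lead, absList A.mid, absList A.low) (1 + j) k v).1 ∧
    IsMaj (fun n => (_root_.run A (n + j) k v).2.1)
      (_root_.run (absList A.lead, absList A.mid, absList A.low) (1 + j) k v).2.1 ∧
    IsMaj (fun n => (_root_.run A (n + j) k v).2.2)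
      (_root_.run (absList A.lead, absList A.mid, absList A.low) (1 + j) k v).2.2 := by
  induction k with
  | zero => exact ⟨const h1, const h2, const h3⟩
  | succ k ih =>
    obtain ⟨i1, i2, i3⟩ := ih
    have e (l : List ℤ) : IsMaj (fun n => _root_.listEval l (n + j + k))
        (_root_.listEval (absList l) (1 + j + k)) := by
      simpa only [add_assoc] using listEval l (j + k)
    exact ⟨(e _).mul i2, ((e _).mul i1).add ((e _).mul i2), (e _).mul i3⟩

/-- The leading coefficient is a nonzero integer, so the remaining coefficients have absolute sum at
most n - 1. The lower terms are then smaller in absolute value than n ^ d, and the leading term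
decides the sign. -/
theorem sign_eq_sign_leadingCoeff {p q : ℤ[X]} (h : ∀ i, |p.coeff i| ≤ q.coeff i) (hp : p ≠ 0)
    {n : ℕ} (hn : q.eval 1 ≤ n) :
    SignType.sign (p.eval (n : ℤ)) = SignType.sign p.leadingCoeff := by
  set d := p.natDegree with hd
  have hq0 (i) : 0 ≤ q.coeff i := (abs_nonneg _).trans (h i)
  have hF : ∑ i ∈ Finset.range d, |p.coeff i| + |p.leadingCoeff| ≤ n := by
    have h1 : q.eval 1 = ∑ i ∈ Finset.range (max d q.natDegree + 1), q.coeff i := by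
      rw [eval_eq_sum_range' (n := max d q.natDegree + 1) (by omega)]
      simp
    calc ∑ i ∈ Finset.range d, |p.coeff i| + |p.leadingCoeff|
        = ∑ i ∈ Finset.range (d + 1), |p.coeff i| := (Finset.sum_range_succ _ _).symm
      _ ≤ ∑ i ∈ Finset.range (d + 1), q.coeff i := Finset.sum_le_sum fun i _ => h i
      _ ≤ ∑ i ∈ Finset.range (max d q.natDegree + 1), q.coeff i :=
        Finset.sum_le_sum_of_subset_of_nonneg
          (Finset.range_mono (by omega)) fun i _ _ => hq0 i
      _ ≤ n := h1 ▸ hn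
  have hc : 1 ≤ |p.leadingCoeff| := Int.one_le_abs (leadingCoeff_ne_zero.2 hp)
  have hn1 : 1 ≤ (n : ℤ) :=
    (hc.trans (le_add_of_nonneg_left (Finset.sum_nonneg fun i _ => abs_nonneg _))).trans hF
  have hpow : 0 < (n : ℤ) ^ d := by positivity
  set S := ∑ i ∈ Finset.range d, p.coeff i * (n : ℤ) ^ i with hS
  have heval : p.eval (n : ℤ) = S + p.leadingCoeff * (n : ℤ) ^ d := by
    rw [eval_eq_sum_range, Finset.sum_range_succ]
    rfl
  have hSn : |S| * n ≤ (n - 1) * (n : ℤ) ^ d := by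
    calc |S| * n ≤ (∑ i ∈ Finset.range d, |p.coeff i| * (n : ℤ) ^ i) * n := by
          refine mul_le_mul_of_nonneg_right ?_ (by positivity)
          refine (Finset.abs_sum_le_sum_abs _ _).trans_eq (Finset.sum_congr rfl fun i _ => ?_)
          rw [abs_mul, abs_of_nonneg (by positivity : (0 : ℤ) ≤ (n : ℤ) ^ i)]
      _ = ∑ i ∈ Finset.range d, |p.coeff i| * (n : ℤ) ^ (i + 1) := by
          rw [Finset.sum_mul]
          exact Finset.sum_congr rfl fun i _ => by ring
      _ ≤ ∑ i ∈ Finset.range d, |p.coeff i| * (n : ℤ) ^ d := by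
          refine Finset.sum_le_sum fun i hi => mul_le_mul_of_nonneg_left ?_ (abs_nonneg _)
          exact pow_le_pow_right₀ hn1 (Finset.mem_range.1 hi)
      _ = (∑ i ∈ Finset.range d, |p.coeff i|) * (n : ℤ) ^ d := (Finset.sum_mul _ _ _).symm
      _ ≤ (n - 1) * (n : ℤ) ^ d := mul_le_mul_of_nonneg_right (by linarith) hpow.le
  have hlt : |S| < (n : ℤ) ^ d := by
    by_contra hge
    push Not at hge
    nlinarith [mul_le_mul_of_nonneg_right hge (by positivity : (0 : ℤ) ≤ n)]
  have hS1 := abs_lt.1 hlt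
  rw [heval]
  rcases lt_trichotomy p.leadingCoeff 0 with hl | hl | hl
  · rw [sign_neg hl, sign_neg]
    nlinarith [mul_le_mul_of_nonneg_right (show p.leadingCoeff ≤ -1 by omega) hpow.le]
  · exact absurd (leadingCoeff_eq_zero.1 hl) hp
  · rw [sign_pos hl, sign_pos]
    nlinarith [mul_le_mul_of_nonneg_right (show 1 ≤ p.leadingCoeff by omega) hpow.le]

theorem sign_eq (h : IsMaj E F) {N n : ℕ} (hN : F ≤ N) (hn : N ≤ n) :
    SignType.sign (E n) = SignType.sign (E N) := by
  obtain ⟨p, q, hpq, hp, rfl⟩ := h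
  rw [hp, hp]
  rcases eq_or_ne p 0 with rfl | h0
  · simp
  · rw [sign_eq_sign_leadingCoeff hpq h0 hN,
      sign_eq_sign_leadingCoeff hpq h0 (hN.trans (by exact_mod_cast hn))]

theorem pos (h : IsMaj E F) {N n : ℕ} (hN : F ≤ N) (hn : N ≤ n) (h0 : 0 < E N) : 0 < E n := by
  rw [← sign_eq_one_iff] at h0 ⊢
  rw [h.sign_eq hN hn, h0]

theorem nonneg (h : IsMaj E F) {N n : ℕ} (hN : F ≤ N) (hn : N ≤ n) (h0 : 0 ≤ E N) :
    0 ≤ E n := by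
  rw [← sign_nonneg_iff] at h0 ⊢
  rwa [h.sign_eq hN hn]

/-- A nonzero polynomial has the nonzero sign of its leading coefficient at N, so a zero at N forces
the zero polynomial. Identities are thus tested at one point. -/
theorem eq_zero (h : IsMaj E F) {N : ℕ} (hN : F ≤ N) (h0 : E N = 0) (n : ℕ) : E n = 0 := by
  obtain ⟨p, q, hpq, hp, rfl⟩ := h
  rcases eq_or_ne p 0 with rfl | hp0
  · simp [hp]
  · have := sign_eq_sign_leadingCoeff hpq hp0 hN
    rw [← hp, h0, sign_zero, eq_comm, sign_eq_zero_iff, leadingCoeff_eq_zero] at this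
    exact absurd this hp0

end IsMaj

theorem Certificate.IsPos.pos {k : Certificate} {l : List ℤ} (h : k.IsPos l) {n : ℕ}
    (hn : k.index ≤ n) : 0 < listEval l n :=
  (IsMaj.listEval l 0).pos h.1 hn h.2

theorem Certificate.IsNonneg.nonneg {k : Certificate} {l : List ℤ} (h : k.IsNonneg l) {n : ℕ}
    (hn : k.index ≤ n) : 0 ≤ listEval l n :=
  (IsMaj.listEval l 0).nonneg h.1 hn h.2

theorem Certificate.IsProp.eq {k : Certificate} {α a β b : List ℤ} (h : k.IsProp α a β b)
    (n : ℕ) : listEval α n * listEval a n = listEval β n * listEval b n :=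
  sub_eq_zero.1 ((((IsMaj.listEval α 0).mul (IsMaj.listEval a 0)).sub
    ((IsMaj.listEval β 0).mul (IsMaj.listEval b 0))).eq_zero h.1 (sub_eq_zero.2 h.2) n)

/-- The invariance identity is split into two sides free of subtraction, so that evaluating the same
expression for `k.abs` at 1 gives a majorant. -/
theorem Certificate.isMaj_lhs (k : Certificate) {v : ℤ × ℤ × ℤ} (h1 : 0 ≤ v.1) (h2 : 0 ≤ v.2.1)
    (h3 : 0 ≤ v.2.2) : IsMaj (k.lhs v) (k.abs.lhs v 1) :=
  (((IsMaj.listEval k.mulNext 0).mul (IsMaj.listEval k.slopeDen k.period)).mul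
      (IsMaj.run k.recData 0 (2 * k.period) h1 h2 h3).1).add
    ((((IsMaj.listEval k.mulCone 0).mul (IsMaj.listEval k.slopeNum 0)).mul
      (IsMaj.run k.recData 0 (2 * k.period) h1 h2 h3).2.2).mul (IsMaj.const h1))

theorem Certificate.isMaj_rhs (k : Certificate) {v : ℤ × ℤ × ℤ} (h1 : 0 ≤ v.1) (h2 : 0 ≤ v.2.1)
    (h3 : 0 ≤ v.2.2) : IsMaj (k.rhs v) (k.abs.rhs v 1) :=
  (((((IsMaj.listEval k.mulNext 0).mul (IsMaj.listEval k.slopeNum k.period)).add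
      ((IsMaj.listEval k.mulCone 0).mul (IsMaj.listEval k.slopeDen 0))).mul
      (IsMaj.run k.recData 0 k.period h1 h2 h3).1).mul
      (IsMaj.run k.recData k.period k.period h1 h2 h3).2.2).add
    (((IsMaj.listEval k.mulBase 0).mul (IsMaj.run k.recData 0 (2 * k.period) h1 h2 h3).2.2).mul
      (IsMaj.const h1))

theorem Certificate.IsInvariant.eq {k : Certificate} {v : ℤ × ℤ × ℤ} (h : k.IsInvariant v)
    (h1 : 0 ≤ v.1) (h2 : 0 ≤ v.2.1) (h3 : 0 ≤ v.2.2) (n : ℕ) :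
    k.lhs v n = k.rhs v n :=
  sub_eq_zero.1 (((k.isMaj_lhs h1 h2 h3).sub (k.isMaj_rhs h1 h2 h3)).eq_zero h.1
    (sub_eq_zero.2 h.2) n)

end Majorants

/-! ### Solutions and values of rational functions -/

section Solutions

variable {K : Type*} [Field K]

theorem evalNat_eq_div (R : RatFunc K) (n : ℕ) :
    evalNat R n = R.num.eval (n : K) / R.denom.eval (n : K) := by
  simp [evalNat, RatFunc.eval]

theorem evalNat_ne_zero {R : RatFunc K} (h : NoZerosOrPoles R) (n : ℕ) : evalNat R n ≠ 0 := by
  rw [evalNat_eq_div]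
  exact div_ne_zero (h n).1 (h n).2

/-- The `(P, Q)`-holonomic sequence with initial value `w`. -/
noncomputable def solution (P Q : RatFunc K) (w : K × K) : ℕ → K
  | 0 => w.1
  | 1 => w.2
  | n + 2 => evalNat P n * solution P Q w (n + 1) + evalNat Q n * solution P Q w n

theorem isHolonomic_solution (P Q : RatFunc K) (w : K × K) : IsHolonomic P Q (solution P Q w) :=
  fun n => by rw [solution]

theorem IsHolonomic.eq_solution {P Q : RatFunc K} {f : ℕ → K} (h : IsHolonomic P Q f) :
    ∀ n, f n = solution P Q (f 0, f 1) n
  | 0 => rfl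
  | 1 => rfl
  | n + 2 => by rw [solution, h n, h.eq_solution n, h.eq_solution (n + 1)]

theorem continuous_solution (P Q : RatFunc ℚ) :
    ∀ n, Continuous fun w : ℚ × ℚ => solution P Q w n
  | 0 => continuous_fst
  | 1 => continuous_snd
  | n + 2 => by
    simp only [solution]
    exact (continuous_const.mul (continuous_solution P Q (n + 1))).add
      (continuous_const.mul (continuous_solution P Q n))

theorem polyOfList_eval (l : List ℤ) (n : ℕ) :
    (polyOfList l).eval (n : ℚ) = (listEval l n : ℚ) := by
  induction l with
  | nil => simp [polyOfList, listEval]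
  | cons a l ih =>
    have : listEval (a :: l) n = a + n * listEval l n := rfl
    rw [polyOfList, eval_add, eval_C, eval_mul, eval_X, ih, this]
    push_cast
    rfl

theorem polynomial_ext_nat {p q : ℚ[X]} (h : ∀ n : ℕ, p.eval (n : ℚ) = q.eval (n : ℚ)) :
    p = q :=
  eq_of_infinite_eval_eq p q ((Set.infinite_range_of_injective (Nat.cast_injective (R := ℚ))).mono
    (Set.range_subset_iff.2 h))

theorem RepresentsRatFunc.num_mul {c : List ℤ × List ℤ} {R : RatFunc ℚ}
    (h : RepresentsRatFunc c R) : R.num * polyOfList c.2 = polyOfList c.1 * R.denom := by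
  obtain ⟨h0, hR⟩ := h
  rw [← R.num_div_denom, div_eq_div_iff] at hR
  · rw [← map_mul, ← map_mul] at hR
    simpa using RatFunc.algebraMap_injective ℚ hR
  · simpa using R.denom_ne_zero
  · simpa using h0

/-- The given fraction need not be in lowest terms, so its denominator may vanish at some n. It is
cancelled as a polynomial, before evaluation. -/
theorem RepresentsRatFunc.mul_evalNat {c : List ℤ × List ℤ} {R : RatFunc ℚ}
    (h : RepresentsRatFunc c R) (hR : NoZerosOrPoles R) {a b : List ℤ}
    (hab : ∀ n, listEval a n * listEval c.1 n = listEval b n * listEval c.2 n) (n : ℕ) :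
    (listEval a n : ℚ) * evalNat R n = listEval b n := by
  have h1 : polyOfList a * polyOfList c.1 = polyOfList b * polyOfList c.2 :=
    polynomial_ext_nat fun n => by
      simp only [eval_mul, polyOfList_eval]
      exact_mod_cast hab n
  have h2 : polyOfList a * R.num = polyOfList b * R.denom := by
    refine mul_right_cancel₀ h.1 ?_
    linear_combination polyOfList a * h.num_mul + R.denom * h1
  have h3 := congrArg (fun p => p.eval (n : ℚ)) h2
  simp only [eval_mul, polyOfList_eval] at h3
  rw [evalNat_eq_div, ← mul_div_assoc, h3, mul_div_assoc, div_self (hR n).2, mul_one]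

end Solutions

/-! ### Iterating the recurrence without division -/

section Run

/-- The sequence `f` satisfies the recurrence with the given coefficients. -/
def RecData.Satisfies (A : RecData) (f : ℕ → ℚ) : Prop :=
  ∀ n, (listEval A.lead n : ℚ) * f (n + 2) = listEval A.mid n * f (n + 1) + listEval A.low n * f n

variable {A : RecData} {f : ℕ → ℚ}

theorem run_add (A : RecData) (n i j : ℕ) (v : ℤ × ℤ × ℤ) :
    run A n (i + j) v = run A (n + i) j (run A n i v) := by
  induction j with
  | zero => rfl
  | succ j ih =>
    change runStep A (n + (i + j)) (run A n (i + j) v) = runStep A (n + i + j) _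
    rw [ih, add_assoc]
    rfl

theorem run_linear (A : RecData) (n k : ℕ) (v : ℤ × ℤ × ℤ) :
    (run A n k v).1 = v.1 * (run A n k (1, 0, 1)).1 + v.2.1 * (run A n k (0, 1, 1)).1 ∧
    (run A n k v).2.1 = v.1 * (run A n k (1, 0, 1)).2.1 + v.2.1 * (run A n k (0, 1, 1)).2.1 ∧
    (run A n k v).2.2 = v.2.2 * (run A n k (1, 0, 1)).2.2 := by
  induction k with
  | zero => simp [run]
  | succ k ih =>
    obtain ⟨h1, h2, h3⟩ := ih
    change (listEval A.lead (n + k) * (run A n k v).2.1 =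
      v.1 * (listEval A.lead (n + k) * (run A n k (1, 0, 1)).2.1) +
        v.2.1 * (listEval A.lead (n + k) * (run A n k (0, 1, 1)).2.1)) ∧
      (listEval A.low (n + k) * (run A n k v).1 + listEval A.mid (n + k) * (run A n k v).2.1 =
        v.1 * (listEval A.low (n + k) * (run A n k (1, 0, 1)).1 +
          listEval A.mid (n + k) * (run A n k (1, 0, 1)).2.1) +
        v.2.1 * (listEval A.low (n + k) * (run A n k (0, 1, 1)).1 +
          listEval A.mid (n + k) * (run A n k (0, 1, 1)).2.1)) ∧
      listEval A.lead (n + k) * (run A n k v).2.2 =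
        v.2.2 * (listEval A.lead (n + k) * (run A n k (1, 0, 1)).2.2)
    rw [h1, h2, h3]
    exact ⟨by ring, by ring, by ring⟩

theorem run_pos {n k : ℕ} (h : ∀ m, n ≤ m → 0 < listEval A.lead m) :
    0 < (run A n k (1, 0, 1)).2.2 := by
  induction k with
  | zero => exact one_pos
  | succ k ih => exact mul_pos (h _ (by omega)) ih

/-- The last entry is a common denominator that is never divided out, so zeros of the leading
coefficient are harmless. -/
theorem RecData.Satisfies.run_state (h : A.Satisfies f) {n : ℕ} {v : ℤ × ℤ × ℤ}
    (h1 : (v.1 : ℚ) = v.2.2 * f n) (h2 : (v.2.1 : ℚ) = v.2.2 * f (n + 1)) (k : ℕ) :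
    ((run A n k v).1 : ℚ) = (run A n k v).2.2 * f (n + k) ∧
    ((run A n k v).2.1 : ℚ) = (run A n k v).2.2 * f (n + k + 1) := by
  induction k with
  | zero => exact ⟨h1, h2⟩
  | succ k ih =>
    obtain ⟨i1, i2⟩ := ih
    change ((listEval A.lead (n + k) * (run A n k v).2.1 : ℤ) : ℚ) =
      ((listEval A.lead (n + k) * (run A n k v).2.2 : ℤ) : ℚ) * f (n + k + 1) ∧
      ((listEval A.low (n + k) * (run A n k v).1 +
        listEval A.mid (n + k) * (run A n k v).2.1 : ℤ) : ℚ) =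
      ((listEval A.lead (n + k) * (run A n k v).2.2 : ℤ) : ℚ) * f (n + k + 2)
    push_cast
    rw [i1, i2]
    refine ⟨by ring, ?_⟩
    linear_combination -((run A n k v).2.2 : ℚ) * h (n + k)

theorem RecData.Satisfies.run_basis (h : A.Satisfies f) (n k : ℕ) :
    ((run A n k (1, 0, 1)).2.2 : ℚ) * f (n + k) =
      (run A n k (1, 0, 1)).1 * f n + (run A n k (0, 1, 1)).1 * f (n + 1) ∧
    ((run A n k (1, 0, 1)).2.2 : ℚ) * f (n + k + 1) =
      (run A n k (1, 0, 1)).2.1 * f n + (run A n k (0, 1, 1)).2.1 * f (n + 1) := by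
  induction k with
  | zero => simp [run]
  | succ k ih =>
    obtain ⟨i1, i2⟩ := ih
    change ((listEval A.lead (n + k) * (run A n k (1, 0, 1)).2.2 : ℤ) : ℚ) * f (n + k + 1) =
        (listEval A.lead (n + k) * (run A n k (1, 0, 1)).2.1 : ℤ) * f n +
        (listEval A.lead (n + k) * (run A n k (0, 1, 1)).2.1 : ℤ) * f (n + 1) ∧
      ((listEval A.lead (n + k) * (run A n k (1, 0, 1)).2.2 : ℤ) : ℚ) * f (n + k + 2) =
        (listEval A.low (n + k) * (run A n k (1, 0, 1)).1 +
          listEval A.mid (n + k) * (run A n k (1, 0, 1)).2.1 : ℤ) * f n +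
        (listEval A.low (n + k) * (run A n k (0, 1, 1)).1 +
          listEval A.mid (n + k) * (run A n k (0, 1, 1)).2.1 : ℤ) * f (n + 1)
    push_cast
    refine ⟨by linear_combination (listEval A.lead (n + k) : ℚ) * i2, ?_⟩
    linear_combination ((run A n k (1, 0, 1)).2.2 : ℚ) * h (n + k) +
      (listEval A.mid (n + k) : ℚ) * i2 + (listEval A.low (n + k) : ℚ) * i1

theorem run_snd_snd_eq (A : RecData) (n k : ℕ) :
    (run A n k (0, 1, 1)).2.2 = (run A n k (1, 0, 1)).2.2 := by
  simpa using (run_linear A n k (0, 1, 1)).2.2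

end Run

/-! ### Soundness: a valid certificate proves stability -/

section Soundness

variable {c : AlgInput} {k : Certificate} {P Q : RatFunc ℚ} {f g : ℕ → ℚ} {v : ℚ × ℚ}

theorem Certificate.Valid.satisfies (h : k.Valid c) (hc : c.Represents P Q v)
    (hP : NoZerosOrPoles P) (hQ : NoZerosOrPoles Q) (hf : IsHolonomic P Q f) :
    k.recData.Satisfies f := by
  intro n
  have h1 := hc.1.mul_evalNat hP h.1.2.1.eq n
  have h2 := hc.2.1.mul_evalNat hQ h.1.2.2.eq n
  rw [hf n, mul_add, ← mul_assoc, ← mul_assoc, h1, h2]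

/-- The linear form whose sign decides on which side of the boundary of the cone `f` lies. -/
noncomputable def Certificate.coneForm (k : Certificate) (f : ℕ → ℚ) (n : ℕ) : ℚ :=
  listEval k.slopeDen n * f (n + k.period) - listEval k.slopeNum n * f n

theorem Certificate.Valid.lead_pos (h : k.Valid c) {n : ℕ} (hn : k.index ≤ n) :
    0 < listEval k.recData.lead n := h.2.1.1.pos hn

theorem Certificate.Valid.run_pos (h : k.Valid c) {n : ℕ} (hn : k.index ≤ n) (i : ℕ) :
    0 < (run k.recData n i (1, 0, 1)).2.2 :=
  _root_.run_pos fun _ hm => h.lead_pos (hn.trans hm)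

/-- Both sides are linear in (f n, f (n + 1)), so the identities tested on the two basis states,
weighted by these values, give the claim. The common denominator is positive beyond the index and
cancels. -/
theorem Certificate.Valid.next_eq (h : k.Valid c) (hf : k.recData.Satisfies f) {n : ℕ}
    (hn : k.index ≤ n) :
    (listEval k.mulNext n : ℚ) * k.coneForm f (n + k.period) =
      listEval k.mulCone n * k.coneForm f n + listEval k.mulBase n * f n := by
  have e1 := h.2.2.2.1.1.eq (by simp) (by simp) (by simp) n
  have e2 := h.2.2.2.1.2.eq (by simp) (by simp) (by simp) n
  have d1 : (0 : ℚ) < (run k.recData n k.period (1, 0, 1)).2.2 := by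
    exact_mod_cast h.run_pos hn _
  have d2 : (0 : ℚ) < (run k.recData (n + k.period) k.period (1, 0, 1)).2.2 := by
    exact_mod_cast h.run_pos (by omega) _
  have hd : (run k.recData n (2 * k.period) (1, 0, 1)).2.2 =
      (run k.recData n k.period (1, 0, 1)).2.2 *
        (run k.recData (n + k.period) k.period (1, 0, 1)).2.2 := by
    rw [two_mul, run_add, (run_linear _ _ _ _).2.2]
  have b1 := (hf.run_basis n k.period).1
  have b2 := (hf.run_basis n (2 * k.period)).1
  simp only [Certificate.lhs, Certificate.rhs, run_snd_snd_eq, hd] at e1 e2 b2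
  have e1' := congrArg (Int.cast : ℤ → ℚ) e1
  have e2' := congrArg (Int.cast : ℤ → ℚ) e2
  push_cast at e1' e2' b2
  have hp : n + k.period + k.period = n + 2 * k.period := by ring
  rw [Certificate.coneForm, Certificate.coneForm, hp]
  generalize f (n + 2 * k.period) = z at *
  generalize f (n + k.period) = y at *
  generalize ((run k.recData n k.period (1, 0, 1)).2.2 : ℚ) = δ at *
  generalize ((run k.recData (n + k.period) k.period (1, 0, 1)).2.2 : ℚ) = δ' at *
  refine mul_left_cancel₀ (mul_pos d1 d2).ne' ?_
  linear_combination f n * e1' + f (n + 1) * e2' + (listEval k.mulNext n : ℚ) *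
    listEval k.slopeDen (n + k.period) * b2 - ((listEval k.mulNext n : ℚ) *
    listEval k.slopeNum (n + k.period) + (listEval k.mulCone n : ℚ) *
    listEval k.slopeDen n) * δ' * b1

/-- Multiplying by `f n`, the cone condition gives slopeDen · f(n+τ) f(n) ≥ slopeNum · f(n)² > 0. -/
theorem Certificate.Valid.sign_step (h : k.Valid c) {n : ℕ} (hn : k.index ≤ n)
    (h0 : f n ≠ 0) (h1 : 0 ≤ k.coneForm f n * f n) : 0 < f (n + k.period) * f n := by
  have hd : (0 : ℚ) < listEval k.slopeDen n := by exact_mod_cast h.2.1.2.2.pos hn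
  have hs : (0 : ℚ) < listEval k.slopeNum n := by exact_mod_cast h.2.1.2.1.pos hn
  have hx := mul_pos hs (mul_self_pos.2 h0)
  rw [Certificate.coneForm] at h1
  refine pos_of_mul_pos_right (a := (listEval k.slopeDen n : ℚ)) ?_ hd.le
  nlinarith

/-- By `next_eq`, the next cone form is a nonnegative combination of two quantities whose signs
agree weakly with that of `f n`, which is also the sign of f(n+τ). -/
theorem Certificate.Valid.cone_step (h : k.Valid c) (hf : k.recData.Satisfies f) {n : ℕ}
    (hn : k.index ≤ n) (h0 : f n ≠ 0) (h1 : 0 ≤ k.coneForm f n * f n) :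
    0 ≤ k.coneForm f (n + k.period) * f (n + k.period) := by
  have h2 := h.sign_step hn h0 h1
  have h3 := h.next_eq hf hn
  have hπ : (0 : ℚ) < listEval k.mulNext n := by exact_mod_cast h.2.2.1.2.pos hn
  have hσ : (0 : ℚ) ≤ listEval k.mulCone n := by exact_mod_cast h.2.2.1.1.1.nonneg hn
  have hμ : (0 : ℚ) ≤ listEval k.mulBase n := by exact_mod_cast h.2.2.1.1.2.nonneg hn
  have hy : 0 < f n * f n := mul_self_pos.2 h0
  have h4 : 0 ≤ k.coneForm f n * f (n + k.period) := by
    refine nonneg_of_mul_nonneg_left (b := f n * f n) ?_ hy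
    calc 0 ≤ (k.coneForm f n * f n) * (f (n + k.period) * f n) := mul_nonneg h1 h2.le
      _ = _ := by ring
  refine nonneg_of_mul_nonneg_right (a := (listEval k.mulNext n : ℚ)) ?_ hπ
  calc 0 ≤ listEval k.mulCone n * (k.coneForm f n * f (n + k.period)) +
        listEval k.mulBase n * (f (n + k.period) * f n) :=
        add_nonneg (mul_nonneg hσ h4) (mul_nonneg hμ h2.le)
    _ = _ := by linear_combination -f (n + k.period) * h3

theorem sign_eq_of_mul_pos {a b : ℚ} (h : 0 < a * b) : SignType.sign a = SignType.sign b := by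
  rcases mul_pos_iff.1 h with ⟨ha, hb⟩ | ⟨ha, hb⟩
  · rw [sign_pos ha, sign_pos hb]
  · rw [sign_neg ha, sign_neg hb]

/-- Only the weak cone condition propagates, as the multipliers may vanish. Together with `f n ≠ 0`
it is enough for the next step. -/
theorem Certificate.Valid.sign_periodic (h : k.Valid c) (hf : k.recData.Satisfies f)
    (h0 : ∀ i < k.period, 0 < k.coneForm f (k.index + i) * f (k.index + i)) {n : ℕ}
    (hn : k.index ≤ n) :
    f n ≠ 0 ∧ 0 ≤ k.coneForm f n * f n := by
  have hτ := h.1.1.1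
  induction n using Nat.strong_induction_on with
  | _ n ih =>
    rcases lt_or_ge n (k.index + k.period) with hlt | hge
    · obtain ⟨i, rfl⟩ := Nat.exists_eq_add_of_le hn
      have := h0 i (by omega)
      exact ⟨right_ne_zero_of_mul this.ne', this.le⟩
    · obtain ⟨m, rfl⟩ := Nat.exists_eq_add_of_le' (show k.period ≤ n by omega)
      obtain ⟨i1, i2⟩ := ih m (by omega) (by omega)
      exact ⟨left_ne_zero_of_mul (h.sign_step (by omega) i1 i2).ne',
        h.cone_step hf (by omega) i1 i2⟩

theorem Certificate.Valid.sign_add_mul (h : k.Valid c) (hf : k.recData.Satisfies f)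
    (h0 : ∀ i < k.period, 0 < k.coneForm f (k.index + i) * f (k.index + i)) {n : ℕ}
    (hn : k.index ≤ n) (j : ℕ) :
    SignType.sign (f (n + j * k.period)) = SignType.sign (f n) := by
  induction j with
  | zero => simp
  | succ j ih =>
    obtain ⟨i1, i2⟩ := h.sign_periodic hf h0 (n := n + j * k.period) (by omega)
    rw [← ih, add_one_mul, ← add_assoc]
    exact sign_eq_of_mul_pos (h.sign_step (by omega) i1 i2)

/-- The sign pattern of `f` with the period given by the certificate. -/
noncomputable def Certificate.pattern (k : Certificate) (f : ℕ → ℚ) : List SignType :=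
  (List.range k.period).map fun i => SignType.sign (f (k.index * k.period + i))

theorem Certificate.Valid.hasUltimateSignAt (h : k.Valid c) (hf : k.recData.Satisfies f)
    (h0 : ∀ i < k.period, 0 < k.coneForm f (k.index + i) * f (k.index + i)) :
    HasUltimateSignAt f (k.pattern f) k.index := by
  have hτ := h.1.1.1
  refine ⟨by simpa [Certificate.pattern] using hτ.ne', fun n hn => ?_⟩
  have hlen : (k.pattern f).length = k.period := by simp [Certificate.pattern]
  have hr := Nat.mod_lt n hτ
  have hdm := Nat.div_add_mod n k.period
  rw [hlen, Certificate.pattern, List.getElem?_map, List.getElem?_range hr, Option.map_some]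
  congr 1
  -- The pattern is sampled from a multiple of the period that is at least the index, so entry i
  -- belongs to the residue class of i. The sample and n are congruent, and the earlier of the two
  -- reaches the other by whole periods.
  have hle : k.index ≤ k.index * k.period + n % k.period :=
    (Nat.le_mul_of_pos_right _ hτ).trans (Nat.le_add_right _ _)
  rcases le_total k.index (n / k.period) with hq | hq
  · rw [← h.sign_add_mul hf h0 hle (n / k.period - k.index)]
    congr 2
    rw [Nat.sub_mul]
    have := Nat.mul_le_mul_right k.period hq
    have := mul_comm k.period (n / k.period)
    omega
  · rw [← h.sign_add_mul hf h0 hn (k.index - n / k.period)]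
    congr 2
    rw [Nat.sub_mul]
    have := Nat.mul_le_mul_right k.period hq
    have := mul_comm k.period (n / k.period)
    omega

theorem Certificate.pattern_congr (h : k.Valid c) (hf : k.recData.Satisfies f)
    (hg : k.recData.Satisfies g)
    (hf0 : ∀ i < k.period, 0 < k.coneForm f (k.index + i) * f (k.index + i))
    (hg0 : ∀ i < k.period, 0 < k.coneForm g (k.index + i) * g (k.index + i))
    (hfg : ∀ i < k.period, 0 < g (k.index + i) * f (k.index + i)) :
    k.pattern g = k.pattern f := by
  have hτ := h.1.1.1
  refine List.map_congr_left fun i _ => ?_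
  have hle : k.index ≤ k.index * k.period + i :=
    (Nat.le_mul_of_pos_right _ hτ).trans (Nat.le_add_right _ _)
  obtain ⟨m, hm⟩ := Nat.exists_eq_add_of_le hle
  have hdm := Nat.div_add_mod m k.period
  rw [hm, show k.index + m = k.index + m % k.period + m / k.period * k.period by
    rw [mul_comm]; omega, h.sign_add_mul hf hf0 (by omega), h.sign_add_mul hg hg0 (by omega)]
  exact sign_eq_of_mul_pos (hfg _ (Nat.mod_lt _ hτ))

/-- The states at n and n+τ have denominators D and Dδ. Clearing them multiplies the cone condition
by D²δ. -/
theorem Certificate.inCone_iff (hf : k.recData.Satisfies f) (hc : c.Represents P Q (f 0, f 1))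
    {n : ℕ} : k.InCone c.init n ↔ (0 : ℚ) < ((run k.recData 0 n c.init).2.2 : ℚ) ^ 2 *
      (run k.recData n k.period (1, 0, 1)).2.2 * (k.coneForm f n * f n) := by
  obtain ⟨-, -, ⟨hc1, hc1'⟩, ⟨hc2, hc2'⟩⟩ := hc
  have hc1q : (c.2.1.2 : ℚ) ≠ 0 := by exact_mod_cast hc1
  have hc2q : (c.2.2.2 : ℚ) ≠ 0 := by exact_mod_cast hc2
  have hs := fun m => (hf.run_state (n := 0) (v := c.init)
    (by
      change ((c.2.1.1 * c.2.2.2 : ℤ) : ℚ) = ((c.2.1.2 * c.2.2.2 : ℤ) : ℚ) * f 0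
      rw [show f 0 = _ from hc1']; push_cast; field_simp)
    (by
      change ((c.2.2.1 * c.2.1.2 : ℤ) : ℚ) = ((c.2.1.2 * c.2.2.2 : ℤ) : ℚ) * f 1
      rw [show f 1 = _ from hc2']; push_cast; field_simp) m).1
  have hn := hs n
  have hn' := hs (n + k.period)
  rw [run_add, (run_linear _ _ _ _).2.2, ← run_add, zero_add, zero_add] at hn'
  rw [zero_add] at hn
  have h2 : ((run k.recData 0 n c.init).2.2 : ℚ) ^ 2 *
      (run k.recData n k.period (1, 0, 1)).2.2 * (k.coneForm f n * f n) =
      (((listEval k.slopeDen n * (run k.recData 0 (n + k.period) c.init).1 -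
      listEval k.slopeNum n * (run k.recData n k.period (1, 0, 1)).2.2 *
      (run k.recData 0 n c.init).1) * (run k.recData 0 n c.init).1 : ℤ) : ℚ) := by
    push_cast
    rw [hn, hn', Certificate.coneForm]
    push_cast
    ring
  rw [h2, Int.cast_pos]
  rfl

theorem Certificate.Valid.coneForm_pos (h : k.Valid c) (hc : c.Represents P Q (f 0, f 1))
    (hf : k.recData.Satisfies f) {i : ℕ} (hi : i < k.period) :
    0 < k.coneForm f (k.index + i) * f (k.index + i) := by
  have hδ : (0 : ℚ) < (run k.recData (k.index + i) k.period (1, 0, 1)).2.2 := by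
    exact_mod_cast h.run_pos (by omega) _
  -- The leading coefficient may vanish below the index, so a priori the square is only nonnegative.
  -- Positivity of the whole product suffices.
  exact pos_of_mul_pos_right ((Certificate.inCone_iff hf hc).1
    (h.2.2.2.2 i (List.mem_range.2 hi))) (mul_nonneg (sq_nonneg _) hδ.le)

/-- Only the cone conditions in the window of length τ after the index involve the initial value.
They are strict and continuous in it, and so are the conditions that the signs in the window agree
with those of f. -/
theorem Certificate.Valid.hasStableUltimateSign (h : k.Valid c)
    (hc : c.Represents P Q (f 0, f 1)) (hP : NoZerosOrPoles P) (hQ : NoZerosOrPoles Q)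
    (hf : IsHolonomic P Q f) :
    HasStableUltimateSign P Q f (k.pattern f) ∧ HasUltimateSignAt f (k.pattern f) k.index := by
  have hs := h.satisfies hc hP hQ hf
  have hf0 := fun i hi => h.coneForm_pos hc hs (i := i) hi
  have h1 := h.hasUltimateSignAt hs hf0
  refine ⟨⟨⟨_, h1⟩, ?_⟩, h1⟩
  have hcont : ∀ i ∈ Finset.range k.period, ∀ᶠ w : ℚ × ℚ in 𝓝 (f 0, f 1),
      0 < k.coneForm (solution P Q w) (k.index + i) * solution P Q w (k.index + i) ∧
        0 < solution P Q w (k.index + i) * f (k.index + i) := by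
    intro i hi
    have hi' := Finset.mem_range.1 hi
    have e := fun m => continuous_solution P Q m
    have e1 : Continuous fun w : ℚ × ℚ =>
        k.coneForm (solution P Q w) (k.index + i) * solution P Q w (k.index + i) :=
      ((continuous_const.mul (e _)).sub (continuous_const.mul (e _))).mul (e _)
    have e2 : Continuous fun w : ℚ × ℚ => solution P Q w (k.index + i) * f (k.index + i) :=
      (e _).mul continuous_const
    have hfs : solution P Q (f 0, f 1) = f := funext fun n => (hf.eq_solution n).symm
    refine (e1.continuousAt.eventually_const_lt ?_).and (e2.continuousAt.eventually_const_lt ?_)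
    · beta_reduce; rw [hfs]; exact hf0 i hi'
    · beta_reduce; rw [hfs]; exact mul_self_pos.2 (right_ne_zero_of_mul (hf0 i hi').ne')
  refine ⟨_, (Filter.eventually_all_finset _).2 hcont, fun g hg hgU => ?_⟩
  have hgs : solution P Q (g 0, g 1) = g := funext fun n => (hg.eq_solution n).symm
  have hU : ∀ i ∈ Finset.range k.period,
      0 < k.coneForm g (k.index + i) * g (k.index + i) ∧
        0 < g (k.index + i) * f (k.index + i) := by
    have := hgU
    simpa only [Set.mem_ofPred_eq, hgs] using this
  have hs' := h.satisfies hc hP hQ hg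
  have hg0 := fun i hi => (hU i (Finset.mem_range.2 hi)).1
  refine ⟨k.index, ?_⟩
  rw [← Certificate.pattern_congr h hs hs' hf0 hg0 fun i hi => (hU i (Finset.mem_range.2 hi)).2]
  exact h.hasUltimateSignAt hs' hg0

end Soundness

/-! ### Oscillation at the critical constant, and growth by the harmonic series -/

section Oscillation

theorem exists_lt_sum_one_div {x : ℕ → ℝ} {τ : ℝ} (hτ : 0 < τ) (hx0 : 0 < x 0)
    (hx : ∀ k, x (k + 1) = x k + τ) (M : ℝ) : ∃ k, M < ∑ i ∈ Finset.range k, 1 / x i := by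
  have hxk (k : ℕ) : x k = x 0 + k * τ := by
    induction k with
    | zero => simp
    | succ k ih => rw [hx, ih]; push_cast; ring
  have h := Real.tendsto_sum_range_one_div_nat_succ_atTop.const_mul_atTop
    (show 0 < 1 / (x 0 + τ) by positivity)
  obtain ⟨k, hk⟩ := (h.eventually_gt_atTop M).exists
  refine ⟨k, hk.trans_le ?_⟩
  rw [Finset.mul_sum]
  refine Finset.sum_le_sum fun i _ => ?_
  rw [one_div_mul_one_div]
  refine one_div_le_one_div_of_le (by rw [hxk]; positivity) ?_
  rw [hxk]
  have : 0 ≤ (i : ℝ) * x 0 := by positivity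
  nlinarith

theorem not_bounded_of_step {σ x : ℕ → ℝ} {τ η : ℝ} (hτ : 0 < τ) (hη : 0 < η) (hx0 : 0 < x 0)
    (hx : ∀ k, x (k + 1) = x k + τ) (hσ : ∀ k, σ k + η / x k ≤ σ (k + 1)) (M : ℝ) :
    ∃ k, M < σ k := by
  obtain ⟨k, hk⟩ := exists_lt_sum_one_div hτ hx0 hx ((M - σ 0) / η)
  refine ⟨k, ?_⟩
  have h : ∀ k, σ 0 + η * ∑ i ∈ Finset.range k, 1 / x i ≤ σ k := by
    intro k
    induction k with
    | zero => simp
    | succ k ih =>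
      rw [Finset.sum_range_succ, mul_add, mul_one_div]
      linarith [hσ k]
  have h1 := h k
  rw [div_lt_iff₀ hη] at hk
  linarith

/-- A Riccati recurrence whose coefficients exceed the critical size has no positive solution. -/
theorem riccati_not_pos {t x ρ : ℕ → ℝ} {τ β : ℝ} (hτ : 0 < τ) (hβ : τ ^ 2 < 16 * β)
    (ht : ∀ k, 0 < t k) (hx0 : 0 < x 0) (hx : ∀ k, x (k + 1) = x k + τ)
    (hr : ∀ k, t (k + 1) = 1 - ρ k / t k) (hρ : ∀ k, 1 / 4 + β / x k ^ 2 ≤ ρ k) : False := by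
  have hβ0 : 0 < β := by nlinarith
  have hxpos (k : ℕ) : 0 < x k := by
    induction k with
    | zero => exact hx0
    | succ k ih => rw [hx]; positivity
  -- From t(t - t') = t² - t + ρ = (t - 1/2)² + (ρ - 1/4). Hence t decreases, and its limit can only
  -- be 1/2.
  have hD (k : ℕ) : (t k - 1 / 2) ^ 2 + β / x k ^ 2 ≤ t k * (t k - t (k + 1)) := by
    have : t k * t (k + 1) = t k - ρ k := by
      rw [hr, mul_sub, mul_div_cancel₀ _ (ht k).ne', mul_one]
    nlinarith [hρ k]
  have hbx (k : ℕ) : 0 < β / x k ^ 2 := div_pos hβ0 (pow_pos (hxpos k) 2)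
  have hanti : Antitone t := antitone_nat_of_succ_le fun k => by
    have h1 : 0 < t k * (t k - t (k + 1)) :=
      (add_pos_of_nonneg_of_pos (sq_nonneg _) (hbx k)).trans_le (hD k)
    linarith [pos_of_mul_pos_right h1 (ht k).le]
  have hlim := tendsto_atTop_ciInf hanti ⟨0, by rintro _ ⟨k, rfl⟩; exact (ht k).le⟩
  set ℓ := ⨅ k, t k
  have hlim' := hlim.comp (Filter.tendsto_add_atTop_nat 1)
  have h0 : (ℓ - 1 / 2) ^ 2 ≤ ℓ * (ℓ - ℓ) := by
    refine le_of_tendsto_of_tendsto' ((hlim.sub_const _).pow 2) (hlim.mul (hlim.sub hlim'))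
      fun k => ?_
    exact (le_add_of_nonneg_right (hbx k).le).trans (hD k)
  have hℓ : ℓ = 1 / 2 := by
    rw [sub_self, mul_zero] at h0
    have := pow_eq_zero_iff (two_ne_zero) |>.1 (le_antisymm h0 (sq_nonneg _))
    linarith
  have hhalf (k : ℕ) : 1 / 2 ≤ t k := hℓ ▸ hanti.le_of_tendsto hlim k
  -- The factor κ = 1 + θ < 2 is ultimately below 1/t, since t tends to 1/2. It keeps η positive
  -- because 4κ²β - τ² = 4β(1 - θ)².
  set θ := τ ^ 2 / (16 * β) with hθ
  have hθ0 : 0 < θ := by positivity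
  have hθ1 : θ < 1 := by rw [hθ, div_lt_one (by positivity)]; exact hβ
  have hθβ : τ ^ 2 = 16 * β * θ := by rw [hθ]; field_simp
  set κ := 1 + θ with hκ
  have hκ0 : 0 < κ := by positivity
  obtain ⟨K, hK⟩ : ∃ K, t K < 1 / κ := by
    refine (hlim.eventually_lt_const ?_).exists
    rw [hℓ, one_div_lt_one_div two_pos hκ0]
    linarith
  set η := κ * β - τ ^ 2 / (4 * κ) with hηdef
  have hη : 0 < η := by
    rw [hηdef, sub_pos, div_lt_iff₀ (by positivity), hθβ, hκ]
    nlinarith [mul_pos hβ0 (pow_pos (sub_pos.2 hθ1) 2)]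
  have hquad (s : ℝ) : η ≤ κ * (s ^ 2 + β) - τ * s := by
    have : κ * (s ^ 2 + β) - τ * s - η = κ * (s - τ / (2 * κ)) ^ 2 := by
      rw [hηdef]; field_simp; ring
    nlinarith [mul_nonneg hκ0.le (sq_nonneg (s - τ / (2 * κ)))]
  -- With s = t - 1/2, the quantity -x s increases by at least (κ((xs)² + β) - τxs)/x ≥ η/x. It
  -- would become positive by divergence of the harmonic series, although s ≥ 0.
  have hstep (k : ℕ) : -(x (K + k) * (t (K + k) - 1 / 2)) + η / x (K + k) ≤
      -(x (K + (k + 1)) * (t (K + (k + 1)) - 1 / 2)) := by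
    rw [← add_assoc, hx]
    have hX := hxpos (K + k)
    have h1 := hD (K + k)
    have h2 : κ * t (K + k) ≤ 1 := by
      have := (hanti (Nat.le_add_right K k)).trans_lt hK
      rw [lt_div_iff₀ hκ0] at this
      linarith
    have h3 := hhalf (K + k + 1)
    have h4 := hquad (x (K + k) * (t (K + k) - 1 / 2))
    have h5 : 0 ≤ t (K + k) - t (K + k + 1) := sub_nonneg.2 (hanti (Nat.le_succ _))
    generalize hs : t (K + k) - 1 / 2 = s at *
    have hs' : t (K + k) = s + 1 / 2 := by linarith
    generalize hs2 : t (K + k + 1) - 1 / 2 = s' at *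
    have hs2' : t (K + k + 1) = s' + 1 / 2 := by linarith
    have h6 : κ * (s ^ 2 + β / x (K + k) ^ 2) ≤ s - s' := by
      have : t (K + k) - t (K + k + 1) = s - s' := by linarith
      rw [this] at h1 h5
      calc κ * (s ^ 2 + β / x (K + k) ^ 2) ≤ κ * (t (K + k) * (s - s')) :=
            mul_le_mul_of_nonneg_left h1 hκ0.le
        _ = (κ * t (K + k)) * (s - s') := by ring
        _ ≤ 1 * (s - s') := mul_le_mul_of_nonneg_right h2 h5
        _ = s - s' := one_mul _
    have h7 : η / x (K + k) ≤ x (K + k) * (κ * (s ^ 2 + β / x (K + k) ^ 2)) - τ * s := by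
      have e : x (K + k) * (κ * (s ^ 2 + β / x (K + k) ^ 2)) - τ * s =
          (κ * ((x (K + k) * s) ^ 2 + β) - τ * (x (K + k) * s)) / x (K + k) := by
        field_simp
      rw [e]
      exact div_le_div_of_nonneg_right h4 hX.le
    have h8 : s' ≤ s := by
      have : t (K + k) - t (K + k + 1) = s - s' := by linarith
      linarith
    have h9 := mul_le_mul_of_nonneg_left h6 hX.le
    have h10 := mul_le_mul_of_nonneg_left h8 hτ.le
    linarith
  obtain ⟨k, hk⟩ := not_bounded_of_step (x := fun k => x (K + k))
    (σ := fun k => -(x (K + k) * (t (K + k) - 1 / 2))) hτ hη (hxpos K)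
    (fun k => by rw [← add_assoc, hx]) hstep 0
  have := mul_nonneg (hxpos (K + k)).le (sub_nonneg.2 (hhalf (K + k)))
  linarith

/-- A solution that starts above the boundary of the cone `X (k + 1) ≤ L k * X k` outgrows all
sequences that stay below it. -/
theorem not_dominates_of_le_slope {X Z p q L m : ℕ → ℝ} {τ ε : ℝ} (hτ : 0 < τ) (hε : 0 < ε)
    (hm0 : 0 < m 0) (hm : ∀ k, m (k + 1) = m k + τ) (hL : ∀ k, 0 < L k)
    (hp : ∀ k, 0 < p k)
    (hLp : ∀ k, L (k + 1) = p k * ((2 * m (k + 1) + τ) / (4 * m (k + 1))))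
    (hq : ∀ k, q k ≤ L k * (p k - L (k + 1)))
    (hZ : ∀ k, Z (k + 2) = p k * Z (k + 1) - q k * Z k) (hZ0 : 0 < Z 0) (hZ1 : L 0 * Z 0 < Z 1)
    (hX : ∀ k, X (k + 1) ≤ L k * X k) {K : ℕ} (hXZ : ∀ k, K ≤ k → ε * |Z k| ≤ X k) : False := by
  have hmpos (k : ℕ) : 0 < m k := by
    induction k with
    | zero => exact hm0
    | succ k ih => rw [hm]; positivity
  set Y : ℕ → ℝ := fun k => ∏ i ∈ Finset.range k, L i with hY
  have hYpos (k : ℕ) : 0 < Y k := Finset.prod_pos fun i _ => hL i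
  have hYs (k : ℕ) : Y (k + 1) = Y k * L k := Finset.prod_range_succ _ _
  -- `Y` satisfies the boundary recursion Y(k+1) = L(k) Y(k), and ψ is the increment of Z/Y. Since m
  -- ψ does not decrease, ψ is at least a constant over m.
  set ψ : ℕ → ℝ := fun k => (Z (k + 1) - L k * Z k) / Y (k + 1) with hψ
  have hψ0 : 0 < ψ 0 := div_pos (sub_pos.2 hZ1) (hYpos 1)
  have key (k : ℕ) : 0 < Z k ∧ m 0 * ψ 0 ≤ m k * ψ k := by
    induction k with
    | zero => exact ⟨hZ0, le_rfl⟩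
    | succ k ih =>
      obtain ⟨i1, i2⟩ := ih
      have hψk : 0 < ψ k := pos_of_mul_pos_right ((mul_pos hm0 hψ0).trans_le i2) (hmpos k).le
      have h1 : 0 < Z (k + 1) - L k * Z k := (div_pos_iff_of_pos_right (hYpos _)).1 hψk
      have hm' := hmpos (k + 1)
      refine ⟨by linarith [mul_pos (hL k) i1], i2.trans ?_⟩
      have hLpos := hL (k + 1)
      have h2 : (p k - L (k + 1)) * (Z (k + 1) - L k * Z k) ≤ Z (k + 2) - L (k + 1) * Z (k + 1) := by
        rw [hZ]
        nlinarith [mul_le_mul_of_nonneg_right (hq k) i1.le]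
      -- The choice of L leaves exactly the surplus pτ²/(4m(k+1)) here. This inequality is what
      -- makes m ψ monotone.
      have h3 : (p k - L (k + 1)) * (m (k + 1) + 0) ≥ L (k + 1) * m k := by
        have e1 : L (k + 1) * (4 * m (k + 1)) = p k * (2 * m (k + 1) + τ) := by
          rw [hLp]; field_simp
        have e2 : m k = m (k + 1) - τ := by rw [hm]; ring
        have e3 : (p k - L (k + 1)) * (m (k + 1) + 0) - L (k + 1) * m k =
            p k * τ ^ 2 / (4 * m (k + 1)) := by
          rw [e2, hLp]; field_simp; ring
        have : 0 ≤ p k * τ ^ 2 / (4 * m (k + 1)) := by have := hp k; positivity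
        linarith
      rw [add_zero] at h3
      have h4 : m (k + 1) * ψ (k + 1) =
          m (k + 1) * (Z (k + 2) - L (k + 1) * Z (k + 1)) / (L (k + 1) * Y (k + 1)) := by
        rw [mul_comm (L (k + 1)) (Y (k + 1)), ← hYs, mul_div_assoc]
      rw [h4, le_div_iff₀ (mul_pos hLpos (hYpos _))]
      calc m k * ψ k * (L (k + 1) * Y (k + 1))
          = L (k + 1) * m k * (Z (k + 1) - L k * Z k) := by
            rw [hψ]; have := (hYpos (k + 1)).ne'; field_simp
        _ ≤ (p k - L (k + 1)) * m (k + 1) * (Z (k + 1) - L k * Z k) :=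
            mul_le_mul_of_nonneg_right h3 h1.le
        _ = m (k + 1) * ((p k - L (k + 1)) * (Z (k + 1) - L k * Z k)) := by ring
        _ ≤ _ := mul_le_mul_of_nonneg_left h2 hm'.le
  have hXY (k : ℕ) : X k ≤ X 0 * Y k := by
    induction k with
    | zero => simp [hY]
    | succ k ih =>
      rw [hYs]
      nlinarith [hX k, mul_le_mul_of_nonneg_left ih (hL k).le]
  have hφ (k : ℕ) : Z (k + 1) / Y (k + 1) = Z k / Y k + ψ k := by
    have e : Z k / Y k = L k * Z k / Y (k + 1) := by
      rw [div_eq_div_iff (hYpos _).ne' (hYpos _).ne', hYs]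
      ring
    rw [e, hψ, ← add_div]
    congr 1
    ring
  -- Z/Y is unbounded, while domination and X ≤ X(0) Y bound it by X(0)/ε from index `K` on.
  obtain ⟨k, hk⟩ := not_bounded_of_step (x := m) (σ := fun k => Z k / Y k) hτ (mul_pos hm0 hψ0)
    hm0 hm (fun k => by
      rw [hφ]
      have := (key k).2
      rw [mul_comm (m k), ← div_le_iff₀ (hmpos k)] at this
      linarith) (X 0 / ε)
  have hmono : Monotone fun k => Z k / Y k := monotone_nat_of_le_succ fun k => by
    rw [hφ]
    have : 0 < ψ k :=
      pos_of_mul_pos_right ((mul_pos hm0 hψ0).trans_le (key k).2) (hmpos k).le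
    linarith
  have h1 := hk.trans_le (hmono (le_max_left k K))
  have h2 := hXZ _ (le_max_right k K)
  have h3 := hXY (max k K)
  rw [abs_of_pos (key _).1] at h2
  simp only [div_lt_div_iff₀ hε (hYpos _)] at h1
  linarith

end Oscillation

/-! ### Oscillation and invariant cones along residue classes -/

section Decimation

theorem eventually_of_residues {p : ℕ → Prop} {τ n₀ : ℕ} (hτ : 0 < τ)
    (hstep : ∀ n, n₀ ≤ n → p n → p (n + τ)) (h : ∀ n, n₀ ≤ n → ∃ k, p (n + k * τ)) :
    ∀ᶠ n in Filter.atTop, p n := by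
  have hmul (n : ℕ) (hn : n₀ ≤ n) (hp : p n) (j : ℕ) : p (n + j * τ) := by
    induction j with
    | zero => simpa using hp
    | succ j ih => rw [add_one_mul, ← add_assoc]; exact hstep _ (by omega) ih
  choose! k hk using h
  refine Filter.eventually_atTop.2
    ⟨n₀ + ((Finset.range τ).sup (fun i => k (n₀ + i)) + 1) * τ, fun n hn => ?_⟩
  have hdm := Nat.div_add_mod (n - n₀) τ
  have hr := Nat.mod_lt (n - n₀) hτ
  set r := (n - n₀) % τ
  have hle : k (n₀ + r) ≤ (n - n₀) / τ := by
    have h1 : k (n₀ + r) ≤ (Finset.range τ).sup (fun i => k (n₀ + i)) :=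
      Finset.le_sup (f := fun i => k (n₀ + i)) (Finset.mem_range.2 hr)
    rw [Nat.le_div_iff_mul_le hτ]
    have := Nat.mul_le_mul_right τ h1
    rw [add_one_mul] at hn
    omega
  have h2 := hmul _ (by omega) (hk (n₀ + r) (by omega)) ((n - n₀) / τ - k (n₀ + r))
  convert h2 using 1
  rw [Nat.sub_mul]
  have := Nat.mul_le_mul_right τ hle
  rw [mul_comm] at hdm
  omega

variable {f p q L m : ℕ → ℝ} {τ n₀ : ℕ}

/-- Oscillation criterion for a second-order recurrence with step `τ`. -/
theorem not_sign_periodic_of_le {β : ℝ} (hτ : 0 < τ) (hn₀ : 0 < n₀)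
    (hf : ∀ n, n₀ ≤ n → 0 < f (n + τ) * f n) (hp : ∀ n, n₀ ≤ n → 0 < p n)
    (hrec : ∀ n, n₀ ≤ n → f (n + 2 * τ) = p n * f (n + τ) - q n * f n)
    (hβ : (τ : ℝ) ^ 2 < 16 * β)
    (hρ : ∀ n, n₀ ≤ n → 1 / 4 + β / (n : ℝ) ^ 2 ≤ q (n + τ) / (p n * p (n + τ))) : False := by
  have hle (k : ℕ) : n₀ ≤ n₀ + k * τ := Nat.le_add_right _ _
  have hdiv (n : ℕ) (hn : n₀ ≤ n) : 0 < f (n + τ) / f n := by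
    have h1 := hf n hn
    have h2 : f (n + τ) / f n = f (n + τ) * f n / (f n * f n) := by
      have := right_ne_zero_of_mul h1.ne'
      field_simp
    rw [h2]
    exact div_pos h1 (mul_self_pos.2 (right_ne_zero_of_mul h1.ne'))
  -- With t = f(n+2τ)/(p(n) f(n+τ)), the recurrence at n+τ becomes the normalised Riccati recurrence
  -- with ρ = q(n+τ)/(p(n)p(n+τ)).
  refine riccati_not_pos (τ := τ) (β := β) (x := fun k => ((n₀ + k * τ : ℕ) : ℝ))
    (t := fun k => f (n₀ + k * τ + τ + τ) / f (n₀ + k * τ + τ) / p (n₀ + k * τ))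
    (ρ := fun k => q (n₀ + k * τ + τ) / (p (n₀ + k * τ) * p (n₀ + k * τ + τ)))
    (by exact_mod_cast hτ) hβ (fun k => ?_) (by simpa using hn₀) (fun k => ?_) (fun k => ?_)
    fun k => hρ _ (hle k)
  · exact div_pos (hdiv _ (by omega)) (hp _ (hle k))
  · push_cast; ring
  · have e : n₀ + (k + 1) * τ = n₀ + k * τ + τ := by ring
    have h1 := hrec (n₀ + k * τ + τ) (by omega)
    have h2 := hp _ (hle k)
    have h3 := hp (n₀ + k * τ + τ) (by omega)
    have h4 := hf (n₀ + k * τ + τ) (by omega)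
    have h5 := left_ne_zero_of_mul h4.ne'
    have h6 := right_ne_zero_of_mul h4.ne'
    rw [two_mul, ← add_assoc] at h1
    rw [e, h1]
    generalize n₀ + k * τ = n at *
    field_simp

/-- A sequence with periodic signs that dominates all solutions enters the cones with slope `L`. -/
theorem eventually_mem_cone (hτ : 0 < τ) (hp : ∀ n, n₀ ≤ n → 0 < p n)
    (hf : ∀ n, n₀ ≤ n → 0 < f (n + τ) * f n)
    (hrec : ∀ n, n₀ ≤ n → f (n + 2 * τ) = p n * f (n + τ) - q n * f n)
    (hL : ∀ n, n₀ ≤ n → 0 < L n) (hm0 : ∀ n, n₀ ≤ n → (τ : ℝ) < 2 * m n)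
    (hm : ∀ n, n₀ ≤ n → m (n + τ) = m n + τ)
    (hLp : ∀ n, n₀ ≤ n → L (n + τ) = p n * ((2 * m (n + τ) + τ) / (4 * m (n + τ))))
    (hq : ∀ n, n₀ ≤ n → q n ≤ L n * (p n - L (n + τ)))
    (hdom : ∀ n, n₀ ≤ n → ∃ g : ℕ → ℝ, g n = 1 ∧ g (n + τ) = 2 * L n ∧
      (∀ i, n₀ ≤ i → g (i + 2 * τ) = p i * g (i + τ) - q i * g i) ∧
      ∃ ε : ℝ, 0 < ε ∧ ∀ᶠ i in Filter.atTop, ε * |g i| ≤ |f i|) :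
    ∀ᶠ n in Filter.atTop, 0 < (f (n + τ) - L n * f n) * f n := by
  have hτ' : (0 : ℝ) < τ := by exact_mod_cast hτ
  refine eventually_of_residues hτ (n₀ := n₀) (fun n hn h => ?_) fun n hn => ?_
  · have h1 := hf n hn
    have h2 : 0 < (f (n + τ) - L n * f n) * f (n + τ) := by
      have h0 : 0 < f n * f n := mul_self_pos.2 (right_ne_zero_of_mul h1.ne')
      refine pos_of_mul_pos_left (b := f n * f n) ?_ h0.le
      calc 0 < (f (n + τ) - L n * f n) * f n * (f (n + τ) * f n) := mul_pos h h1
        _ = _ := by ring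
    have h3 : 0 < p n - L (n + τ) := by
      have hm1 := hm0 (n + τ) (by omega)
      have hm2 : 0 < m (n + τ) := by linarith
      have : p n - L (n + τ) = p n * ((2 * m (n + τ) - τ) / (4 * m (n + τ))) := by
        rw [hLp n hn]; field_simp; ring
      rw [this]
      exact mul_pos (hp n hn) (div_pos (by linarith) (by linarith))
    -- The next cone form is (p - L') f(n+τ) - q f(n), where L' = L(n+τ). By `hq` it exceeds (p -
    -- L') times the current form, up to the common sign.
    rw [show n + τ + τ = n + 2 * τ by ring, hrec n hn]
    have h4 := mul_nonneg (sub_nonneg.2 (hq n hn)) h1.le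
    nlinarith [mul_pos h3 h2]
  -- A residue class that never enters keeps |f(n+τ)| ≤ L |f(n)|. The solution g with slope 2L
  -- starts above the boundary and contradicts domination.
  · by_contra! hcon
    obtain ⟨g, hg0, hg1, hgrec, ε, hε, hεg⟩ := hdom n hn
    obtain ⟨K, hK⟩ := Filter.eventually_atTop.1 hεg
    have e (k : ℕ) : n + (k + 1) * τ = n + k * τ + τ := by ring
    have e2 (k : ℕ) : n + (k + 2) * τ = n + k * τ + 2 * τ := by ring
    have hle (k : ℕ) : n₀ ≤ n + k * τ := by omega
    refine not_dominates_of_le_slope (X := fun k => |f (n + k * τ)|)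
      (Z := fun k => g (n + k * τ)) (p := fun k => p (n + k * τ)) (q := fun k => q (n + k * τ))
      (L := fun k => L (n + k * τ)) (m := fun k => m (n + k * τ)) (τ := τ) (ε := ε) (K := K)
      hτ' hε ?_ (fun k => ?_) (fun k => hL _ (hle k)) (fun k => hp _ (hle k)) (fun k => ?_)
      (fun k => ?_) (fun k => ?_) ?_ ?_ (fun k => ?_) fun k hk => ?_
    · have := hm0 (n + 0 * τ) (hle 0)
      linarith
    · rw [e, hm _ (hle k)]
    · rw [e, hLp _ (hle k)]
    · rw [e]; exact hq _ (hle k)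
    · rw [e2, e]; exact hgrec _ (hle k)
    · rw [zero_mul, add_zero, hg0]; exact one_pos
    · rw [zero_mul, add_zero, one_mul, hg0, hg1]
      linarith [hL n hn]
    · rw [e]
      have h1 := hcon k
      have h2 := hf _ (hle k)
      have h3 := hL _ (hle k)
      generalize n + k * τ = i at *
      rcases mul_pos_iff.1 h2 with ⟨ha, hb⟩ | ⟨ha, hb⟩
      · rw [abs_of_pos ha, abs_of_pos hb]
        by_contra! hlt
        exact absurd h1 (not_le.2 (mul_pos (sub_pos.2 hlt) hb))
      · rw [abs_of_neg ha, abs_of_neg hb]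
        by_contra! hlt
        refine absurd h1 (not_le.2 (mul_pos_of_neg_of_neg ?_ hb))
        linarith
    · refine hK _ (hk.trans ?_)
      exact (Nat.le_mul_of_pos_right k hτ).trans (Nat.le_add_left _ _)

end Decimation

/-! ### Integer polynomial functions and their growth -/

section PolynomialFunctions

/-- `E` is a polynomial function with integer coefficients. -/
def IsPolyFun (E : ℕ → ℤ) : Prop := ∃ p : ℤ[X], ∀ n : ℕ, E n = p.eval (n : ℤ)

namespace IsPolyFun

variable {E E' : ℕ → ℤ}

theorem const (a : ℤ) : IsPolyFun fun _ => a := ⟨C a, fun n => by simp⟩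

theorem natCast : IsPolyFun fun n => (n : ℤ) := ⟨X, fun n => by simp⟩

theorem add (h : IsPolyFun E) (h' : IsPolyFun E') : IsPolyFun fun n => E n + E' n := by
  obtain ⟨p, hp⟩ := h
  obtain ⟨p', hp'⟩ := h'
  exact ⟨p + p', fun n => by simp [hp, hp']⟩

theorem sub (h : IsPolyFun E) (h' : IsPolyFun E') : IsPolyFun fun n => E n - E' n := by
  obtain ⟨p, hp⟩ := h
  obtain ⟨p', hp'⟩ := h'
  exact ⟨p - p', fun n => by simp [hp, hp']⟩

theorem mul (h : IsPolyFun E) (h' : IsPolyFun E') : IsPolyFun fun n => E n * E' n := by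
  obtain ⟨p, hp⟩ := h
  obtain ⟨p', hp'⟩ := h'
  exact ⟨p * p', fun n => by simp [hp, hp']⟩

theorem shift (h : IsPolyFun E) (j : ℕ) : IsPolyFun fun n => E (n + j) := by
  obtain ⟨p, hp⟩ := h
  exact ⟨p.comp (X + C (j : ℤ)), fun n => by simp [hp]⟩

theorem _root_.IsMaj.isPolyFun {F : ℤ} (h : IsMaj E F) : IsPolyFun E := by
  obtain ⟨p, q, -, hp, -⟩ := h
  exact ⟨p, hp⟩

theorem listEval (l : List ℤ) : IsPolyFun (listEval l) := (IsMaj.listEval l 0).isPolyFun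

theorem run (A : RecData) (k : ℕ) {v : ℤ × ℤ × ℤ} (h1 : 0 ≤ v.1) (h2 : 0 ≤ v.2.1)
    (h3 : 0 ≤ v.2.2) :
    IsPolyFun (fun n => (run A n k v).1) ∧ IsPolyFun (fun n => (_root_.run A n k v).2.1) ∧
      IsPolyFun (fun n => (_root_.run A n k v).2.2) :=
  ⟨(IsMaj.run A 0 k h1 h2 h3).1.isPolyFun, (IsMaj.run A 0 k h1 h2 h3).2.1.isPolyFun,
    (IsMaj.run A 0 k h1 h2 h3).2.2.isPolyFun⟩

theorem exists_list_eval (p : ℤ[X]) : ∃ l : List ℤ, ∀ n : ℕ,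
    _root_.listEval l n = p.eval (n : ℤ) := by
  induction p using Polynomial.recOnHorner with
  | M0 => exact ⟨[], fun n => by simp [_root_.listEval]⟩
  | MC p a _ _ ih =>
    obtain ⟨l, hl⟩ := ih
    cases l with
    | nil =>
      refine ⟨[a], fun n => ?_⟩
      simp only [_root_.listEval, List.foldr] at hl ⊢
      rw [eval_add, eval_C, ← hl]
      ring
    | cons b l =>
      refine ⟨(b + a) :: l, fun n => ?_⟩
      simp only [_root_.listEval, List.foldr] at hl ⊢
      rw [eval_add, eval_C, ← hl]
      ring
  | MX p _ ih =>
    obtain ⟨l, hl⟩ := ih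
    refine ⟨0 :: l, fun n => ?_⟩
    simp only [_root_.listEval, List.foldr] at hl ⊢
    rw [eval_mul, eval_X, ← hl]
    ring

theorem exists_list (h : IsPolyFun E) : ∃ l : List ℤ, ∀ n, _root_.listEval l n = E n := by
  obtain ⟨p, hp⟩ := h
  obtain ⟨l, hl⟩ := exists_list_eval p
  exact ⟨l, fun n => by rw [hl, hp]⟩

theorem exists_list_shift (h : IsPolyFun E) (j : ℕ) :
    ∃ l : List ℤ, ∀ n, _root_.listEval l (n + j) = E n := by
  obtain ⟨p, hp⟩ := h
  obtain ⟨l, hl⟩ := exists_list_eval (p.comp (X - C (j : ℤ)))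
  exact ⟨l, fun n => by rw [hl, hp]; simp⟩

theorem trichotomy (h : IsPolyFun E) :
    (∀ n, E n = 0) ∨ (∀ᶠ n in Filter.atTop, 0 < E n) ∨ ∀ᶠ n in Filter.atTop, E n < 0 := by
  obtain ⟨l, hl⟩ := h.exists_list
  have hM : IsMaj E (_root_.listEval (absList l) 1) := by
    simpa only [add_zero, hl] using IsMaj.listEval l 0
  set F := _root_.listEval (absList l) 1
  have hF : F ≤ (F.toNat : ℤ) := Int.self_le_toNat F
  rcases lt_trichotomy (E F.toNat) 0 with h0 | h0 | h0
  · refine Or.inr (Or.inr (Filter.eventually_atTop.2 ⟨F.toNat, fun n hn => ?_⟩))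
    have := hM.sign_eq hF hn
    rwa [sign_neg h0, sign_eq_neg_one_iff] at this
  · exact Or.inl (hM.eq_zero hF h0)
  · exact Or.inr (Or.inl (Filter.eventually_atTop.2 ⟨F.toNat, fun n hn => hM.pos hF hn h0⟩))

/-- Degrees are integers, so either E has smaller degree than E', which gains a full factor n, or E'
= O(E). In the latter case the ultimate sign of E selects the alternative. -/
theorem growth (h : IsPolyFun E) (h' : IsPolyFun E') (hpos : ∀ᶠ n in Filter.atTop, 0 < E' n) :
    ∃ c : ℝ, 0 < c ∧ ((∀ᶠ n : ℕ in Filter.atTop, (n : ℝ) * E n ≤ c * E' n) ∨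
      ∀ᶠ n : ℕ in Filter.atTop, (E' n : ℝ) ≤ c * E n) := by
  obtain ⟨p, hp⟩ := h
  obtain ⟨p', hp'⟩ := h'
  have hcast (r : ℤ[X]) (n : ℕ) :
      (r.map (Int.castRingHom ℝ)).eval (n : ℝ) = ((r.eval (n : ℤ) : ℤ) : ℝ) := by
    rw [eval_natCast_map]; simp
  have hdeg (r : ℤ[X]) : (r.map (Int.castRingHom ℝ)).degree = r.degree :=
    degree_map_eq_of_injective Int.cast_injective r
  rcases lt_or_ge p.degree p'.degree with hlt | hge
  · have h1 : ((X * p).map (Int.castRingHom ℝ)).degree ≤ (p'.map (Int.castRingHom ℝ)).degree := by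
      rw [hdeg, hdeg, degree_mul, degree_X, add_comm]
      exact Nat.WithBot.add_one_le_of_lt hlt
    obtain ⟨c, hc, hO⟩ := ((isBigO_atTop_of_degree_le _ _ h1).comp_tendsto
      tendsto_natCast_atTop_atTop).exists_pos
    refine ⟨c, hc, Or.inl ?_⟩
    filter_upwards [hO.bound, hpos] with n hn hn'
    simp only [Function.comp, hcast, Real.norm_eq_abs] at hn
    rw [← hp', eval_mul, eval_X, ← hp, abs_of_pos (by exact_mod_cast hn' : (0 : ℝ) < E' n)] at hn
    push_cast at hn
    exact (le_abs_self _).trans hn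
  · obtain ⟨c, hc, hO⟩ := ((isBigO_atTop_of_degree_le (p'.map (Int.castRingHom ℝ))
      (p.map (Int.castRingHom ℝ)) (by rwa [hdeg, hdeg])).comp_tendsto
      tendsto_natCast_atTop_atTop).exists_pos
    have key : ∀ᶠ n : ℕ in Filter.atTop, |(E' n : ℝ)| ≤ c * |(E n : ℝ)| := by
      filter_upwards [hO.bound] with n hn
      simpa only [Function.comp, hcast, Real.norm_eq_abs, ← hp, ← hp'] using hn
    refine ⟨c, hc, ?_⟩
    rcases trichotomy ⟨p, hp⟩ with h0 | h0 | h0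
    · refine Or.inl ?_
      filter_upwards [hpos] with n hn
      rw [h0]
      have : (0 : ℝ) < E' n := by exact_mod_cast hn
      simp only [Int.cast_zero, mul_zero]
      positivity
    · refine Or.inr ?_
      filter_upwards [key, hpos, h0] with n hn h1 h2
      rwa [abs_of_pos (by exact_mod_cast h1), abs_of_pos (by exact_mod_cast h2)] at hn
    · refine Or.inl ?_
      filter_upwards [hpos, h0] with n h1 h2
      have h1' : (0 : ℝ) < E' n := by exact_mod_cast h1
      have h2' : (E n : ℝ) ≤ 0 := by exact_mod_cast h2.le
      exact (mul_nonpos_of_nonneg_of_nonpos n.cast_nonneg h2').trans (by positivity)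

end IsPolyFun

end PolynomialFunctions

/-! ### Choice of the slope -/

section Slope

/-- With m = n - C, the target reads A/B ≤ 1/4 + τ²/(16m(m+τ)), since (2m+τ)² = 4m(m+τ) + τ². The
shift C turns the error term c/(16n³) of the hypothesis into part of this main term. -/
theorem kneser_bound {n τ c C A B : ℝ} (hτ : 1 ≤ τ) (hc : 0 < c) (hC : c + τ ≤ C) (hn : C < n)
    (hB : 0 < B) (h : n * (n ^ 2 * (16 * A - 4 * B) - τ ^ 2 * B) ≤ c * B) :
    16 * ((n - C) * (n - C + τ)) * A ≤ (2 * (n - C) + τ) ^ 2 * B := by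
  have hn0 : 0 < n := by linarith
  set m := n - C with hm
  have hm0 : 0 < m := by linarith
  suffices hD : m * (m + τ) * (16 * A - 4 * B) ≤ τ ^ 2 * B by nlinarith
  set D := 16 * A - 4 * B
  rcases le_or_gt D 0 with hD | hD
  · exact (mul_nonpos_of_nonneg_of_nonpos (by positivity) hD).trans (by positivity)
  have h1 : m * (m + τ) * D ≤ m * n * D := by
    refine mul_le_mul_of_nonneg_right (mul_le_mul_of_nonneg_left ?_ hm0.le) hD.le
    linarith
  have h2 : n ^ 2 * (m * n * D) ≤ n ^ 2 * (τ ^ 2 * B) := by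
    have h3 : m * (n * τ ^ 2 + c) ≤ n ^ 2 * τ ^ 2 := by
      have h4 : c ≤ C * τ ^ 2 := by nlinarith [one_le_pow₀ hτ (n := 2)]
      have h5 : 0 ≤ C * c := mul_nonneg (by linarith) hc.le
      rw [hm]
      nlinarith [mul_le_mul_of_nonneg_left h4 hn0.le]
    calc n ^ 2 * (m * n * D) = m * (n * (n ^ 2 * D)) := by ring
      _ ≤ m * ((n * τ ^ 2 + c) * B) := mul_le_mul_of_nonneg_left (by linarith) hm0.le
      _ = m * (n * τ ^ 2 + c) * B := by ring
      _ ≤ n ^ 2 * τ ^ 2 * B := mul_le_mul_of_nonneg_right h3 hB.le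
      _ = _ := by ring
  exact h1.trans (le_of_mul_le_mul_left h2 (by positivity))

variable {f : ℕ → ℝ} {p₁ p₂ q₁ : ℕ → ℤ} {τ n₀ : ℕ}

/-- Apply `growth` to n²(16A - 4B) - τ²B and B, where ρ = A/B. One alternative is the hypothesis of
`kneser_bound`. The other puts ρ above the critical size and contradicts sign periodicity. -/
theorem exists_kneser_constant (hτ : 0 < τ) (hp₁ : IsPolyFun p₁) (hp₂ : IsPolyFun p₂)
    (hq₁ : IsPolyFun q₁) (hp₁0 : ∀ n, n₀ ≤ n → 0 < p₁ n) (hp₂0 : ∀ n, n₀ ≤ n → 0 < p₂ n)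
    (hf : ∀ n, n₀ ≤ n → 0 < f (n + τ) * f n)
    (hrec : ∀ n, n₀ ≤ n → f (n + 2 * τ) = p₁ n / p₂ n * f (n + τ) - q₁ n / p₂ n * f n) :
    ∃ C : ℕ, ∀ᶠ n : ℕ in Filter.atTop,
      16 * (((n : ℝ) - C) * (n - C + τ)) * (q₁ (n + τ) * p₂ n) ≤
        (2 * ((n : ℝ) - C) + τ) ^ 2 * (p₁ (n + τ) * p₁ n) := by
  have hB : IsPolyFun fun n => p₁ (n + τ) * p₁ n := (hp₁.shift τ).mul hp₁
  have hA : IsPolyFun fun n => q₁ (n + τ) * p₂ n := (hq₁.shift τ).mul hp₂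
  have hE : IsPolyFun fun n => (n : ℤ) * n * (16 * (q₁ (n + τ) * p₂ n) - 4 * (p₁ (n + τ) * p₁ n)) -
      (τ : ℤ) ^ 2 * (p₁ (n + τ) * p₁ n) :=
    ((IsPolyFun.natCast.mul .natCast).mul (((IsPolyFun.const 16).mul hA).sub
      ((IsPolyFun.const 4).mul hB))).sub ((IsPolyFun.const ((τ : ℤ) ^ 2)).mul hB)
  have hBpos : ∀ᶠ n in Filter.atTop, 0 < p₁ (n + τ) * p₁ n :=
    Filter.eventually_atTop.2 ⟨n₀, fun n hn => mul_pos (hp₁0 _ (by omega)) (hp₁0 _ hn)⟩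
  obtain ⟨c, hc, h | h⟩ := hE.growth hB hBpos
  · refine ⟨⌈c + τ⌉₊, ?_⟩
    filter_upwards [h, hBpos, Filter.eventually_gt_atTop ⌈c + τ⌉₊] with n hn hn1 hn2
    push_cast at hn
    refine kneser_bound (by exact_mod_cast hτ) hc (Nat.le_ceil _) (by exact_mod_cast hn2)
      (by exact_mod_cast hn1) ?_
    rw [pow_two (n : ℝ)]
    exact hn
  · exfalso
    obtain ⟨n₁, hn₁⟩ := Filter.eventually_atTop.1 h
    -- Here E ≥ B/c, that is, ρ ≥ 1/4 + (τ² + 1/c)/(16n²), which determines β.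
    refine not_sign_periodic_of_le (f := f) (p := fun n => p₁ n / p₂ n) (q := fun n => q₁ n / p₂ n)
      (τ := τ) (n₀ := max (max n₀ n₁) 1) (β := (τ ^ 2 + 1 / c) / 16) hτ (by simp)
      (fun n hn => hf n (by omega)) (fun n hn => ?_) (fun n hn => hrec n (by omega)) ?_
      fun n hn => ?_
    · exact div_pos (by exact_mod_cast hp₁0 n (by omega)) (by exact_mod_cast hp₂0 n (by omega))
    · have : 0 < 1 / c := by positivity
      linarith
    · have e1 := hn₁ n (by omega)
      have b1 : (0 : ℝ) < p₁ n := by exact_mod_cast hp₁0 n (by omega)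
      have b2 : (0 : ℝ) < p₁ (n + τ) := by exact_mod_cast hp₁0 (n + τ) (by omega)
      have b3 : (0 : ℝ) < p₂ n := by exact_mod_cast hp₂0 n (by omega)
      have b4 : (0 : ℝ) < p₂ (n + τ) := by exact_mod_cast hp₂0 (n + τ) (by omega)
      have b5 : (0 : ℝ) < n := by exact_mod_cast (show 0 < n by omega)
      push_cast at e1
      have e2 : (q₁ (n + τ) : ℝ) / p₂ (n + τ) / (p₁ n / p₂ n * (p₁ (n + τ) / p₂ (n + τ))) =
          (q₁ (n + τ) * p₂ n) / (p₁ (n + τ) * p₁ n) := by field_simp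
      rw [e2]
      generalize (q₁ (n + τ) : ℝ) * p₂ n = A at *
      have b6 := mul_pos b2 b1
      generalize (p₁ (n + τ) : ℝ) * p₁ n = B at *
      rw [le_div_iff₀ b6]
      have e3 : (1 / 4 + (↑τ ^ 2 + 1 / c) / 16 / (n : ℝ) ^ 2) * B =
          (4 * c * n ^ 2 * B + c * τ ^ 2 * B + B) / (16 * c * n ^ 2) := by
        field_simp
        ring
      rw [e3, div_le_iff₀ (by positivity)]
      nlinarith

/-- The slopes of an invariant family of cones which every dominant solution with periodic signs
enters. -/
theorem exists_slope (hτ : 0 < τ) (hp₁ : IsPolyFun p₁) (hp₂ : IsPolyFun p₂)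
    (hq₁ : IsPolyFun q₁) (hp₁0 : ∀ n, n₀ ≤ n → 0 < p₁ n) (hp₂0 : ∀ n, n₀ ≤ n → 0 < p₂ n)
    (hf : ∀ n, n₀ ≤ n → 0 < f (n + τ) * f n)
    (hrec : ∀ n, n₀ ≤ n → f (n + 2 * τ) = p₁ n / p₂ n * f (n + τ) - q₁ n / p₂ n * f n)
    (hdom : ∀ n, n₀ ≤ n → ∀ y : ℚ, ∃ g : ℕ → ℝ, g n = 1 ∧ g (n + τ) = y ∧
      (∀ i, n₀ ≤ i → g (i + 2 * τ) = p₁ i / p₂ i * g (i + τ) - q₁ i / p₂ i * g i) ∧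
      ∃ ε : ℝ, 0 < ε ∧ ∀ᶠ i in Filter.atTop, ε * |g i| ≤ |f i|) :
    ∃ l₁ l₂ : List ℤ, ∀ᶠ n in Filter.atTop, 0 < listEval l₁ n ∧ 0 < listEval l₂ n ∧
      0 ≤ listEval l₂ (n + τ) * p₁ n - listEval l₁ (n + τ) * p₂ n ∧
      0 ≤ (listEval l₂ (n + τ) * p₁ n - listEval l₁ (n + τ) * p₂ n) * listEval l₁ n -
        listEval l₂ (n + τ) * listEval l₂ n * q₁ n ∧
      0 < (listEval l₂ n * f (n + τ) - listEval l₁ n * f n) * f n := by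
  obtain ⟨C, hC⟩ := exists_kneser_constant hτ hp₁ hp₂ hq₁ hp₁0 hp₂0 hf hrec
  obtain ⟨n₁, hn₁⟩ := Filter.eventually_atTop.1 hC
  have hm : IsPolyFun fun n => (n : ℤ) - C := IsPolyFun.natCast.sub (.const C)
  -- The slope at n+τ is p(n)(2m+τ)/(4m) with m = n - C. It is prescribed at the shifted argument,
  -- hence the shifted lists.
  obtain ⟨l₁, hl₁⟩ := (hp₁.mul (((IsPolyFun.const 2).mul hm).add (.const τ))).exists_list_shift τ
  obtain ⟨l₂, hl₂⟩ := (((IsPolyFun.const 4).mul hp₂).mul hm).exists_list_shift τ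
  refine ⟨l₁, l₂, ?_⟩
  set n₂ := max (max n₀ n₁) (C + τ) + τ with hn₂
  have hcast₁ (n : ℕ) : (listEval l₁ (n + τ) : ℝ) = p₁ n * (2 * ((n : ℝ) - C) + τ) := by
    rw [hl₁]; push_cast; ring
  have hcast₂ (n : ℕ) : (listEval l₂ (n + τ) : ℝ) = 4 * p₂ n * ((n : ℝ) - C) := by
    rw [hl₂]; push_cast; ring
  have hτ' : (0 : ℝ) < τ := by exact_mod_cast hτ
  have hmpos (n : ℕ) (hn : C + τ ≤ n) : (τ : ℝ) ≤ (n : ℝ) - C := by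
    have : ((C + τ : ℕ) : ℝ) ≤ n := by exact_mod_cast hn
    push_cast at this
    linarith
  have b₁ (n : ℕ) (hn : n₀ ≤ n) : (0 : ℝ) < p₁ n := by exact_mod_cast hp₁0 n hn
  have b₂ (n : ℕ) (hn : n₀ ≤ n) : (0 : ℝ) < p₂ n := by exact_mod_cast hp₂0 n hn
  have hpos₁ (n : ℕ) (hn : n₂ ≤ n) : (0 : ℝ) < listEval l₁ n := by
    obtain ⟨j, rfl⟩ := Nat.exists_eq_add_of_le' (show τ ≤ n by omega)
    rw [hcast₁]
    have := hmpos j (by omega)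
    exact mul_pos (b₁ j (by omega)) (by linarith)
  have hpos₂ (n : ℕ) (hn : n₂ ≤ n) : (0 : ℝ) < listEval l₂ n := by
    obtain ⟨j, rfl⟩ := Nat.exists_eq_add_of_le' (show τ ≤ n by omega)
    rw [hcast₂]
    have := hmpos j (by omega)
    have := b₂ j (by omega)
    exact mul_pos (by linarith) (by linarith)
  have hL (n : ℕ) (hn : n₂ ≤ n) : (listEval l₁ (n + τ) : ℝ) / listEval l₂ (n + τ) =
      p₁ n / p₂ n * ((2 * ((n : ℝ) - C) + τ) / (4 * ((n : ℝ) - C))) := by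
    rw [hcast₁, hcast₂, div_mul_div_comm]
    congr 1
    ring
  have hgap (n : ℕ) (hn : n₂ ≤ n) :
      (0 : ℝ) < p₁ n / p₂ n - listEval l₁ (n + τ) / listEval l₂ (n + τ) := by
    have h1 := hmpos n (by omega)
    have h2 : (0 : ℝ) < (n : ℝ) - C := by linarith
    have h3 : (p₁ n : ℝ) / p₂ n - listEval l₁ (n + τ) / listEval l₂ (n + τ) =
        p₁ n / p₂ n * ((2 * ((n : ℝ) - C) - τ) / (4 * ((n : ℝ) - C))) := by
      rw [hL n hn]
      have := (b₂ n (by omega)).ne'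
      field_simp
      ring
    rw [h3]
    exact mul_pos (div_pos (b₁ n (by omega)) (b₂ n (by omega)))
      (div_pos (by linarith) (by linarith))
  -- Writing n = j + τ and inserting both slopes turns the invariance condition into exactly the
  -- bound from `exists_kneser_constant` at j.
  have hq (n : ℕ) (hn : n₂ + τ ≤ n) : (q₁ n : ℝ) / p₂ n ≤ listEval l₁ n / listEval l₂ n *
      (p₁ n / p₂ n - listEval l₁ (n + τ) / listEval l₂ (n + τ)) := by
    obtain ⟨j, rfl⟩ := Nat.exists_eq_add_of_le' (show τ ≤ n by omega)
    rw [hL j (by omega), hL (j + τ) (by omega)]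
    have h1 := hmpos j (by omega)
    have h2 := hn₁ j (by omega)
    have h3 := b₁ j (by omega)
    have h4 := b₂ j (by omega)
    have h5 := b₁ (j + τ) (by omega)
    have h6 := b₂ (j + τ) (by omega)
    push_cast
    rw [show (j : ℝ) + τ - C = (j - C) + τ by ring]
    generalize (j : ℝ) - C = m at *
    have hm0 : 0 < m := by linarith
    have hm1 : 0 < m + τ := by linarith
    have e : (p₁ j : ℝ) / p₂ j * ((2 * m + τ) / (4 * m)) * (p₁ (j + τ) / p₂ (j + τ) -
        p₁ (j + τ) / p₂ (j + τ) * ((2 * (m + τ) + τ) / (4 * (m + τ)))) =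
        (2 * m + τ) ^ 2 * (p₁ (j + τ) * p₁ j) / (16 * (m * (m + τ)) * p₂ j * p₂ (j + τ)) := by
      field_simp
      ring
    rw [e, div_le_div_iff₀ h6 (by positivity)]
    calc (q₁ (j + τ) : ℝ) * (16 * (m * (m + τ)) * p₂ j * p₂ (j + τ))
        = 16 * (m * (m + τ)) * (q₁ (j + τ) * p₂ j) * p₂ (j + τ) := by ring
      _ ≤ _ := mul_le_mul_of_nonneg_right h2 h6.le
  have hcone := eventually_mem_cone (f := f) (p := fun n => p₁ n / p₂ n)
    (q := fun n => q₁ n / p₂ n) (L := fun n => listEval l₁ n / listEval l₂ n)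
    (m := fun n => (n : ℝ) - τ - C) (τ := τ) (n₀ := n₂ + τ + τ) hτ
    (fun n hn => div_pos (b₁ n (by omega)) (b₂ n (by omega))) (fun n hn => hf n (by omega))
    (fun n hn => hrec n (by omega))
    (fun n hn => div_pos (hpos₁ n (by omega)) (hpos₂ n (by omega)))
    (fun n hn => by
      obtain ⟨j, rfl⟩ := Nat.exists_eq_add_of_le' (show τ ≤ n by omega)
      have := hmpos j (by omega)
      push_cast
      linarith)
    (fun n hn => by push_cast; ring)
    (fun n hn => by
      rw [hL n (by omega)]
      push_cast
      rw [add_sub_cancel_right])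
    (fun n hn => hq n (by omega))
    (fun n hn => by
      -- The slope 2 l₁/l₂ is rational, as required: stability controls only perturbations with
      -- rational initial values.
      obtain ⟨g, h1, h2, h3, h4⟩ := hdom n (by omega) (2 * (listEval l₁ n / listEval l₂ n))
      refine ⟨g, h1, by rw [h2]; push_cast; rfl, fun i hi => h3 i (by omega), h4⟩)
  filter_upwards [hcone, Filter.eventually_ge_atTop (n₂ + τ)] with n hn1 hn2
  have c₁ := hpos₁ n (by omega)
  have c₂ := hpos₂ n (by omega)
  have c₂' := hpos₂ (n + τ) (by omega)
  have d₂ := b₂ n (by omega)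
  have h1 := hgap n (by omega)
  have h2 := hq n hn2
  refine ⟨by exact_mod_cast c₁, by exact_mod_cast c₂, ?_, ?_, ?_⟩
  · have : (0 : ℝ) ≤ listEval l₂ (n + τ) * p₁ n - listEval l₁ (n + τ) * p₂ n := by
      calc (0 : ℝ) ≤ listEval l₂ (n + τ) * p₂ n *
          (p₁ n / p₂ n - listEval l₁ (n + τ) / listEval l₂ (n + τ)) := by positivity
        _ = _ := by field_simp
    exact_mod_cast this
  · have : (0 : ℝ) ≤ (listEval l₂ (n + τ) * p₁ n - listEval l₁ (n + τ) * p₂ n) * listEval l₁ n -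
        listEval l₂ (n + τ) * listEval l₂ n * q₁ n := by
      calc (0 : ℝ) ≤ listEval l₂ (n + τ) * listEval l₂ n * p₂ n * (listEval l₁ n / listEval l₂ n *
          (p₁ n / p₂ n - listEval l₁ (n + τ) / listEval l₂ (n + τ)) - q₁ n / p₂ n) :=
            mul_nonneg (by positivity) (sub_nonneg.2 h2)
        _ = _ := by field_simp
    exact_mod_cast this
  · have e : ((listEval l₂ n : ℝ) * f (n + τ) - listEval l₁ n * f n) * f n =
        listEval l₂ n * ((f (n + τ) - listEval l₁ n / listEval l₂ n * f n) * f n) := by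
      field_simp
    rw [e]
    exact mul_pos c₂ hn1

end Slope

/-! ### Choosing the index of a certificate -/

section Validity

variable {c : AlgInput} {P Q : RatFunc ℚ} {f : ℕ → ℚ}

/-- The certificate with a new index. -/
def Certificate.withIndex (k : Certificate) (N : ℕ) : Certificate := (k.1, (k.2.1, (k.period, N)))

theorem eventually_majorant_le (F : ℤ) : ∀ᶠ N : ℕ in Filter.atTop, F ≤ N :=
  Filter.eventually_atTop.2
    ⟨F.toNat, fun n hn => (Int.self_le_toNat F).trans (by exact_mod_cast hn)⟩

/-- Each requirement holds for all large indices, the majorants being constants, so one index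
satisfies all of them. -/
theorem Certificate.exists_valid (k : Certificate) (hτ : 0 < k.period)
    (hf : k.recData.Satisfies f) (hc : c.Represents P Q (f 0, f 1))
    (hlead : ∀ n, listEval k.recData.lead n ≠ 0)
    (hleadpos : ∀ᶠ n in Filter.atTop, 0 < listEval k.recData.lead n)
    (hP : ∀ n, listEval k.recData.lead n * listEval c.1.1.1 n =
      listEval k.recData.mid n * listEval c.1.1.2 n)
    (hQ : ∀ n, listEval k.recData.lead n * listEval c.1.2.1 n =
      listEval k.recData.low n * listEval c.1.2.2 n)
    (hnum : ∀ᶠ n in Filter.atTop, 0 < listEval k.slopeNum n)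
    (hden : ∀ᶠ n in Filter.atTop, 0 < listEval k.slopeDen n)
    (hmulCone : ∀ᶠ n in Filter.atTop, 0 ≤ listEval k.mulCone n)
    (hmulBase : ∀ᶠ n in Filter.atTop, 0 ≤ listEval k.mulBase n)
    (hmulNext : ∀ᶠ n in Filter.atTop, 0 < listEval k.mulNext n)
    (h1 : ∀ᶠ n in Filter.atTop, k.lhs (1, 0, 1) n = k.rhs (1, 0, 1) n)
    (h2 : ∀ᶠ n in Filter.atTop, k.lhs (0, 1, 1) n = k.rhs (0, 1, 1) n)
    (hcone : ∀ᶠ n in Filter.atTop, 0 < k.coneForm f n * f n) :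
    ∃ k' : Certificate, k'.Valid c := by
  have hcone' : ∀ᶠ N in Filter.atTop, ∀ n, N ≤ n → 0 < k.coneForm f n * f n := by
    obtain ⟨N, hN⟩ := Filter.eventually_atTop.1 hcone
    exact Filter.eventually_atTop.2 ⟨N, fun M hM n hn => hN n (hM.trans hn)⟩
  have hlead' : ∀ᶠ N in Filter.atTop, ∀ n, N ≤ n → 0 < listEval k.recData.lead n := by
    obtain ⟨N, hN⟩ := Filter.eventually_atTop.1 hleadpos
    exact Filter.eventually_atTop.2 ⟨N, fun M hM n hn => hN n (hM.trans hn)⟩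
  have B := eventually_majorant_le
  -- Ultimate positivity of the leading coefficient is not enough: the integer test starts at 0 and
  -- would degenerate if a denominator on the way vanished.
  have hD (n : ℕ) : (run k.recData 0 n c.init).2.2 ≠ 0 := by
    induction n with
    | zero =>
      refine mul_ne_zero ?_ ?_
      · exact_mod_cast hc.2.2.1.1
      · exact_mod_cast hc.2.2.2.1
    | succ n ih => exact mul_ne_zero (hlead _) ih
  have L := fun l : List ℤ => B (listEval (absList l) 1)
  have hall := (((((B (listEval (absList k.recData.lead) 1 * listEval (absList c.1.1.1) 1 +
      listEval (absList k.recData.mid) 1 * listEval (absList c.1.1.2) 1)).and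
      (B (listEval (absList k.recData.lead) 1 * listEval (absList c.1.2.1) 1 +
        listEval (absList k.recData.low) 1 * listEval (absList c.1.2.2) 1))).and
      ((L k.recData.lead).and (L k.slopeNum))).and
      (((L k.slopeDen).and (L k.mulCone)).and ((L k.mulBase).and (L k.mulNext)))).and
    (((B (k.abs.lhs (1, 0, 1) 1 + k.abs.rhs (1, 0, 1) 1)).and
      (B (k.abs.lhs (0, 1, 1) 1 + k.abs.rhs (0, 1, 1) 1))).and (h1.and h2))).and
    (((Filter.eventually_gt_atTop 0).and (hleadpos.and (hnum.and hden))).and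
    ((hmulCone.and (hmulBase.and hmulNext)).and (hcone'.and hlead')))
  obtain ⟨N, ⟨⟨⟨⟨b1, b2⟩, ⟨b3, b4⟩⟩, ⟨⟨b5, b6⟩, ⟨b7, b8⟩⟩⟩, ⟨⟨b9, b10⟩, ⟨e1, e2⟩⟩⟩,
    ⟨⟨p0, ⟨p1, ⟨p2, p3⟩⟩⟩, ⟨⟨p4, ⟨p5, p6⟩⟩, ⟨p7, p8⟩⟩⟩⟩ := hall.exists
  refine ⟨k.withIndex N, ⟨⟨hτ, p0⟩, ⟨b1, hP N⟩, ⟨b2, hQ N⟩⟩, ⟨⟨b3, p1⟩, ⟨b4, p2⟩, ⟨b5, p3⟩⟩,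
    ⟨⟨⟨b6, p4⟩, ⟨b7, p5⟩⟩, ⟨b8, p6⟩⟩, ⟨⟨b9, e1⟩, ⟨b10, e2⟩⟩, fun i _ => ?_⟩
  refine (Certificate.inCone_iff (k := k.withIndex N) hf hc).2 ?_
  have d1 : (0 : ℚ) < (run k.recData (N + i) k.period (1, 0, 1)).2.2 := by
    exact_mod_cast run_pos fun m hm => p8 m (by omega)
  have d2 : ((run k.recData 0 (N + i) c.init).2.2 : ℚ) ≠ 0 := by exact_mod_cast hD _
  exact mul_pos (mul_pos (sq_pos_of_ne_zero d2) d1) (p7 _ (Nat.le_add_right N i))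

end Validity

/-! ### The polynomial recurrence and its solution space -/

section Recurrence

/-- Integer coefficient lists of numerator and denominator of `R`. -/
theorem RepresentsRatFunc.exists_lists {c : List ℤ × List ℤ} {R : RatFunc ℚ}
    (h : RepresentsRatFunc c R) (hR : NoZerosOrPoles R) :
    ∃ a b : List ℤ, ∀ n : ℕ, listEval a n ≠ 0 ∧ listEval b n ≠ 0 ∧
      listEval b n * listEval c.1 n = listEval a n * listEval c.2 n := by
  obtain ⟨x, hx, hp⟩ := IsLocalization.integerNormalization_spec (nonZeroDivisors ℤ) R.num
  obtain ⟨y, hy, hq⟩ := IsLocalization.integerNormalization_spec (nonZeroDivisors ℤ) R.denom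
  generalize IsLocalization.integerNormalization (nonZeroDivisors ℤ) R.num = p at hp
  generalize IsLocalization.integerNormalization (nonZeroDivisors ℤ) R.denom = q at hq
  have hx0 : (x : ℚ) ≠ 0 := by exact_mod_cast nonZeroDivisors.ne_zero hx
  have hy0 : (y : ℚ) ≠ 0 := by exact_mod_cast nonZeroDivisors.ne_zero hy
  obtain ⟨a, ha⟩ := IsPolyFun.exists_list_eval (p * C y)
  obtain ⟨b, hb⟩ := IsPolyFun.exists_list_eval (q * C x)
  have hev (r : ℤ[X]) (n : ℕ) :
      ((r.eval (n : ℤ) : ℤ) : ℚ) = (r.map (algebraMap ℤ ℚ)).eval (n : ℚ) := by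
    rw [eval_natCast_map]; simp
  have ha' (n : ℕ) : (listEval a n : ℚ) = x * y * R.num.eval (n : ℚ) := by
    rw [ha, eval_mul, eval_C, Int.cast_mul, hev, hp]
    simp
    ring
  have hb' (n : ℕ) : (listEval b n : ℚ) = x * y * R.denom.eval (n : ℚ) := by
    rw [hb, eval_mul, eval_C, Int.cast_mul, hev, hq]
    simp
    ring
  refine ⟨a, b, fun n => ⟨fun h0 => ?_, fun h0 => ?_, ?_⟩⟩
  · exact mul_ne_zero (mul_ne_zero hx0 hy0) (hR n).1 (by rw [← ha', h0, Int.cast_zero])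
  · exact mul_ne_zero (mul_ne_zero hx0 hy0) (hR n).2 (by rw [← hb', h0, Int.cast_zero])
  · have h3 := congrArg (fun p => p.eval (n : ℚ)) h.num_mul
    simp only [eval_mul, polyOfList_eval] at h3
    have h4 : (listEval b n : ℚ) * listEval c.1 n = listEval a n * listEval c.2 n := by
      rw [ha', hb']
      linear_combination -(x * y : ℚ) * h3
    exact_mod_cast h4

/-- The given fractions may have common factors vanishing on the natural numbers. Reduced fractions,
scaled to integer coefficients, avoid this. -/
theorem AlgInput.Represents.exists_recData {c : AlgInput} {P Q : RatFunc ℚ} {v : ℚ × ℚ}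
    (hc : c.Represents P Q v) (hP : NoZerosOrPoles P) (hQ : NoZerosOrPoles Q) :
    ∃ A : RecData, (∀ n : ℕ, listEval A.lead n ≠ 0) ∧
      (∀ᶠ n in Filter.atTop, 0 < listEval A.lead n) ∧
      (∀ n, listEval A.lead n * listEval c.1.1.1 n = listEval A.mid n * listEval c.1.1.2 n) ∧
      (∀ n, listEval A.lead n * listEval c.1.2.1 n = listEval A.low n * listEval c.1.2.2 n) ∧
      ∀ n : ℕ, listEval A.low n ≠ 0 := by
  obtain ⟨a, b, hab⟩ := hc.1.exists_lists hP
  obtain ⟨a', b', hab'⟩ := hc.2.1.exists_lists hQ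
  -- The sign s makes the common denominator ultimately positive.
  have key : ∃ s : ℤ, s ≠ 0 ∧ ∀ᶠ n in Filter.atTop, 0 < s * (listEval b n * listEval b' n) := by
    rcases ((IsPolyFun.listEval b).mul (.listEval b')).trichotomy with h | h | h
    · exact absurd (h 0) (mul_ne_zero (hab 0).2.1 (hab' 0).2.1)
    · exact ⟨1, one_ne_zero, by simpa only [one_mul] using h⟩
    · exact ⟨-1, by simp, by simpa using h⟩
  obtain ⟨s, hs, hpos⟩ := key
  obtain ⟨l₁, h₁⟩ :=
      ((IsPolyFun.const s).mul ((IsPolyFun.listEval b).mul (.listEval b'))).exists_list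
  obtain ⟨l₂, h₂⟩ :=
      ((IsPolyFun.const s).mul ((IsPolyFun.listEval a).mul (.listEval b'))).exists_list
  obtain ⟨l₃, h₃⟩ :=
      ((IsPolyFun.const s).mul ((IsPolyFun.listEval b).mul (.listEval a'))).exists_list
  refine ⟨(l₁, l₂, l₃), fun n => ?_, ?_, fun n => ?_, fun n => ?_, fun n => ?_⟩
  · exact (h₁ n).trans_ne (mul_ne_zero hs (mul_ne_zero (hab n).2.1 (hab' n).2.1))
  · filter_upwards [hpos] with n hn
    exact hn.trans_eq (h₁ n).symm
  · change listEval l₁ n * _ = listEval l₂ n * _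
    rw [h₁, h₂]
    linear_combination s * listEval b' n * (hab n).2.2
  · change listEval l₁ n * _ = listEval l₃ n * _
    rw [h₁, h₃]
    linear_combination s * listEval b n * (hab' n).2.2
  · exact (h₃ n).trans_ne (mul_ne_zero hs (mul_ne_zero (hab n).2.1 (hab' n).1))

theorem IsHolonomic.satisfies {c : AlgInput} {P Q : RatFunc ℚ} {v : ℚ × ℚ} {A : RecData}
    {g : ℕ → ℚ} (hg : IsHolonomic P Q g) (hc : c.Represents P Q v) (hP : NoZerosOrPoles P)
    (hQ : NoZerosOrPoles Q)
    (h1 : ∀ n, listEval A.lead n * listEval c.1.1.1 n = listEval A.mid n * listEval c.1.1.2 n)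
    (h2 : ∀ n, listEval A.lead n * listEval c.1.2.1 n = listEval A.low n * listEval c.1.2.2 n) :
    A.Satisfies g := fun n => by
  rw [hg n]
  linear_combination g (n + 1) * hc.1.mul_evalNat hP h1 n + g n * hc.2.1.mul_evalNat hQ h2 n

/-- The recurrence can be solved backwards because `Q` has no zeros in ℕ. -/
theorem exists_isHolonomic_eq {K : Type*} [Field K] {P Q : RatFunc K} (hQ : NoZerosOrPoles Q)
    (n : ℕ) (x y : K) : ∃ g, IsHolonomic P Q g ∧ g n = x ∧ g (n + 1) = y := by
  induction n generalizing x y with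
  | zero => exact ⟨solution P Q (x, y), isHolonomic_solution _ _ _, rfl, rfl⟩
  | succ n ih =>
    obtain ⟨g, hg, h1, h2⟩ := ih ((y - evalNat P n * x) / evalNat Q n) x
    refine ⟨g, hg, h2, ?_⟩
    rw [hg n, h1, h2, mul_div_cancel₀ _ (evalNat_ne_zero hQ n)]
    ring

theorem IsHolonomic.add_const_mul {K : Type*} [Field K] {P Q : RatFunc K} {f g : ℕ → K}
    (hf : IsHolonomic P Q f) (hg : IsHolonomic P Q g) (t : K) :
    IsHolonomic P Q fun n => f n + t * g n := fun n => by
  simp only [hf n, hg n]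
  ring

theorem solution_eq_add {K : Type*} [Field K] (P Q : RatFunc K) (w : K × K) :
    ∀ n, solution P Q w n = w.1 * solution P Q (1, 0) n + w.2 * solution P Q (0, 1) n
  | 0 => by simp [solution]
  | 1 => by simp [solution]
  | n + 2 => by
    simp only [solution]
    rw [solution_eq_add P Q w n, solution_eq_add P Q w (n + 1)]
    ring

end Recurrence

/-! ### Domination and nonvanishing from stability -/

section Stability

variable {P Q : RatFunc ℚ} {f g : ℕ → ℚ} {s : List SignType}

/-- For a small rational q > 0, both f + q g and f - q g ultimately have the sign of f, which forces
q|g| ≤ |f|. -/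
theorem HasStableUltimateSign.exists_dominates (h : HasStableUltimateSign P Q f s)
    (hf : IsHolonomic P Q f) (hg : IsHolonomic P Q g) :
    ∃ ε : ℚ, 0 < ε ∧ ∀ᶠ n in Filter.atTop, ε * |g n| ≤ |f n| := by
  obtain ⟨⟨N, -, hN⟩, U, hU, hUs⟩ := h
  have hcont : Filter.Tendsto (fun t : ℚ => ((f 0 + t * g 0, f 1 + t * g 1) : ℚ × ℚ)) (𝓝 0)
      (𝓝 (f 0, f 1)) := by
    have : Continuous fun t : ℚ => ((f 0 + t * g 0, f 1 + t * g 1) : ℚ × ℚ) :=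
      (continuous_const.add (continuous_id.mul continuous_const)).prodMk
        (continuous_const.add (continuous_id.mul continuous_const))
    simpa using this.tendsto 0
  obtain ⟨ε, hε, hball⟩ := Metric.eventually_nhds_iff.1 (hcont hU)
  obtain ⟨q, hq0, hq1⟩ := exists_rat_btwn hε
  have hq0' : 0 < q := by exact_mod_cast hq0
  have hdist : dist q 0 < ε := by
    rw [Rat.dist_eq]
    simpa [abs_of_pos hq0] using hq1
  have hdist' : dist (-q) 0 < ε := by
    rw [Rat.dist_eq]
    simpa [abs_of_pos hq0] using hq1
  obtain ⟨N₁, -, h₁⟩ := hUs _ (hf.add_const_mul hg q) (hball hdist)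
  obtain ⟨N₂, -, h₂⟩ := hUs _ (hf.add_const_mul hg (-q)) (hball hdist')
  refine ⟨q, hq0', ?_⟩
  filter_upwards [Filter.eventually_ge_atTop (max N (max N₁ N₂))] with n hn
  have e := hN n (by omega)
  have e₁ : SignType.sign (f n + q * g n) = SignType.sign (f n) :=
    Option.some_injective _ ((h₁ n (by omega)).symm.trans e)
  have e₂ : SignType.sign (f n + -q * g n) = SignType.sign (f n) :=
    Option.some_injective _ ((h₂ n (by omega)).symm.trans e)
  rw [show q * |g n| = |q * g n| by rw [abs_mul, abs_of_pos hq0']]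
  rcases lt_trichotomy (f n) 0 with hf0 | hf0 | hf0
  · rw [sign_neg hf0, sign_eq_neg_one_iff] at e₁ e₂
    rw [abs_of_neg hf0, abs_le]
    constructor <;> linarith
  · rw [hf0, sign_zero, sign_eq_zero_iff, zero_add] at e₁
    rw [e₁, abs_zero]
    exact abs_nonneg _
  · rw [sign_pos hf0, sign_eq_one_iff] at e₁ e₂
    rw [abs_of_pos hf0, abs_le]
    constructor <;> linarith

/-- A zero of f at a large n would, by domination, be a zero of both basis solutions. Then every
solution would vanish at n, although values at n can be prescribed. -/
theorem HasStableUltimateSign.eventually_ne_zero (h : HasStableUltimateSign P Q f s)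
    (hf : IsHolonomic P Q f) (hQ : NoZerosOrPoles Q) : ∀ᶠ n in Filter.atTop, f n ≠ 0 := by
  obtain ⟨ε₁, hε₁, h₁⟩ := h.exists_dominates hf (isHolonomic_solution P Q (1, 0))
  obtain ⟨ε₂, hε₂, h₂⟩ := h.exists_dominates hf (isHolonomic_solution P Q (0, 1))
  filter_upwards [h₁, h₂] with n h₁ h₂ h0
  rw [h0, abs_zero] at h₁ h₂
  obtain ⟨g, hg, hg1, -⟩ := exists_isHolonomic_eq (P := P) hQ n 1 0
  refine one_ne_zero (hg1.symm.trans ?_)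
  rw [hg.eq_solution, solution_eq_add, abs_nonpos_iff.1 (nonpos_of_mul_nonpos_right h₁ hε₁),
    abs_nonpos_iff.1 (nonpos_of_mul_nonpos_right h₂ hε₂), mul_zero, mul_zero, add_zero]

theorem HasUltimateSign.eventually_sign_add (h : HasUltimateSign f s) (j : ℕ) :
    ∀ᶠ n in Filter.atTop, SignType.sign (f (n + j * s.length)) = SignType.sign (f n) := by
  obtain ⟨N, -, hN⟩ := h
  filter_upwards [Filter.eventually_ge_atTop N] with n hn
  have h1 := hN (n + j * s.length) (by omega)
  rw [Nat.add_mul_mod_self_right, hN n hn] at h1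
  exact (Option.some_injective _ h1).symm

theorem HasStableUltimateSign.eventually_mul_pos (h : HasStableUltimateSign P Q f s)
    (hf : IsHolonomic P Q f) (hQ : NoZerosOrPoles Q) (j : ℕ) :
    ∀ᶠ n in Filter.atTop, 0 < f (n + j * s.length) * f n := by
  filter_upwards [h.1.eventually_sign_add j, h.eventually_ne_zero hf hQ] with n h1 h2
  rw [← sign_eq_one_iff, sign_mul, h1, ← sign_mul, sign_eq_one_iff]
  exact mul_self_pos.2 h2

end Stability

/-! ### Decimated recurrences and completeness -/

section Decimated

theorem run_two_mul (A : RecData) (n τ : ℕ) :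
    (run A n (2 * τ) (1, 0, 1)).1 = (run A n τ (1, 0, 1)).1 * (run A (n + τ) τ (1, 0, 1)).1 +
      (run A n τ (1, 0, 1)).2.1 * (run A (n + τ) τ (0, 1, 1)).1 ∧
    (run A n (2 * τ) (0, 1, 1)).1 = (run A n τ (0, 1, 1)).1 * (run A (n + τ) τ (1, 0, 1)).1 +
      (run A n τ (0, 1, 1)).2.1 * (run A (n + τ) τ (0, 1, 1)).1 ∧
    (run A n (2 * τ) (1, 0, 1)).2.2 =
      (run A n τ (1, 0, 1)).2.2 * (run A (n + τ) τ (1, 0, 1)).2.2 := by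
  rw [two_mul, run_add, run_add]
  exact ⟨(run_linear _ _ _ _).1, (run_linear _ _ _ _).1, (run_linear _ _ _ _).2.2⟩

/-- The determinant of the transition matrix from `n` to `n + k`, with denominators cleared. -/
def runDet (A : RecData) (n k : ℕ) : ℤ :=
  (run A n k (1, 0, 1)).1 * (run A n k (0, 1, 1)).2.1 -
    (run A n k (0, 1, 1)).1 * (run A n k (1, 0, 1)).2.1

theorem runDet_succ (A : RecData) (n k : ℕ) : runDet A n (k + 1) =
    -(listEval A.lead (n + k) * listEval A.low (n + k)) * runDet A n k := by
  change listEval A.lead (n + k) * (run A n k (1, 0, 1)).2.1 *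
      (listEval A.low (n + k) * (run A n k (0, 1, 1)).1 +
        listEval A.mid (n + k) * (run A n k (0, 1, 1)).2.1) -
    listEval A.lead (n + k) * (run A n k (0, 1, 1)).2.1 *
      (listEval A.low (n + k) * (run A n k (1, 0, 1)).1 +
        listEval A.mid (n + k) * (run A n k (1, 0, 1)).2.1) = _
  rw [runDet]
  ring

/-- Each step contributes a factor -αγ, with leading and lowest coefficients α and γ. Over an even
number of steps the minus signs cancel, and ultimately γ has constant sign, so all paired factors
are positive. -/
theorem eventually_runDet_pos {A : RecData} (hlead : ∀ᶠ n in Filter.atTop, 0 < listEval A.lead n)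
    (hlow : ∀ n : ℕ, listEval A.low n ≠ 0) (j : ℕ) :
    ∀ᶠ n in Filter.atTop, 0 < runDet A n (2 * j) := by
  have hlow' : ∀ᶠ n in Filter.atTop, 0 < listEval A.low n * listEval A.low (n + 1) := by
    rcases (IsPolyFun.listEval A.low).trichotomy with h | h | h
    · exact absurd (h 0) (hlow 0)
    · filter_upwards [h, (Filter.tendsto_add_atTop_nat 1).eventually h] with n h1 h2
      exact mul_pos h1 h2
    · filter_upwards [h, (Filter.tendsto_add_atTop_nat 1).eventually h] with n h1 h2
      exact mul_pos_of_neg_of_neg h1 h2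
  obtain ⟨N, hN⟩ := Filter.eventually_atTop.1 (hlead.and hlow')
  refine Filter.eventually_atTop.2 ⟨N, fun n hn => ?_⟩
  induction j with
  | zero => simp [runDet, run]
  | succ j ih =>
    rw [show 2 * (j + 1) = 2 * j + 1 + 1 by ring, runDet_succ, runDet_succ]
    have h1 := hN (n + 2 * j) (by omega)
    have h2 := hN (n + 2 * j + 1) (by omega)
    have h3 := mul_pos (mul_pos (mul_pos h1.1 h2.1) h1.2) ih
    rw [← add_assoc]
    linarith

/-- The polynomials `p₁`, `p₂`, `q₁` express the recurrence
`p₂(n) f(n+2τ) = p₁(n) f(n+τ) - q₁(n) f(n)` for the solutions of a recurrence. -/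
structure IsDecimation (A : RecData) (τ : ℕ) (p₁ p₂ q₁ : ℕ → ℤ) : Prop where
  poly₁ : IsPolyFun p₁
  poly₂ : IsPolyFun p₂
  poly₃ : IsPolyFun q₁
  fst : ∀ n, p₂ n * (run A n (2 * τ) (1, 0, 1)).1 =
    p₁ n * (run A n τ (1, 0, 1)).1 * (run A (n + τ) τ (1, 0, 1)).2.2 -
      q₁ n * (run A n (2 * τ) (1, 0, 1)).2.2
  snd : ∀ n, p₂ n * (run A n (2 * τ) (0, 1, 1)).1 =
    p₁ n * (run A n τ (0, 1, 1)).1 * (run A (n + τ) τ (1, 0, 1)).2.2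

variable {A : RecData} {τ : ℕ} {p₁ p₂ q₁ : ℕ → ℤ}

theorem IsDecimation.recurrence (h : IsDecimation A τ p₁ p₂ q₁) {g : ℕ → ℚ} (hg : A.Satisfies g)
    {n : ℕ} (hn : ∀ m, n ≤ m → 0 < listEval A.lead m) :
    (p₂ n : ℚ) * g (n + 2 * τ) = p₁ n * g (n + τ) - q₁ n * g n := by
  have e₁ : (p₂ n : ℚ) * (run A n (2 * τ) (1, 0, 1)).1 = p₁ n * (run A n τ (1, 0, 1)).1 *
      (run A (n + τ) τ (1, 0, 1)).2.2 - q₁ n * (run A n (2 * τ) (1, 0, 1)).2.2 := by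
    exact_mod_cast h.fst n
  have e₂ : (p₂ n : ℚ) * (run A n (2 * τ) (0, 1, 1)).1 =
      p₁ n * (run A n τ (0, 1, 1)).1 * (run A (n + τ) τ (1, 0, 1)).2.2 := by
    exact_mod_cast h.snd n
  have e₃ : ((run A n (2 * τ) (1, 0, 1)).2.2 : ℚ) =
      (run A n τ (1, 0, 1)).2.2 * (run A (n + τ) τ (1, 0, 1)).2.2 := by
    exact_mod_cast (run_two_mul A n τ).2.2
  have h1 := (hg.run_basis n τ).1
  have h2 := (hg.run_basis n (2 * τ)).1
  have h3 : (0 : ℚ) < (run A n (2 * τ) (1, 0, 1)).2.2 := by exact_mod_cast run_pos hn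
  refine mul_left_cancel₀ h3.ne' ?_
  rw [mul_left_comm, h2]
  linear_combination g n * e₁ + g (n + 1) * e₂ -
    (p₁ n * (run A (n + τ) τ (1, 0, 1)).2.2 : ℚ) * h1 - p₁ n * g (n + τ) * e₃

/-- Here f(n+τ) does not depend on f(n+1), so the decimated recurrence has order one. -/
theorem isDecimation_of_eq_zero (hu : ∀ n, (run A n τ (0, 1, 1)).1 = 0) :
    IsDecimation A τ (fun n => (run A (n + τ) τ (1, 0, 1)).1)
      (fun n => (run A (n + τ) τ (1, 0, 1)).2.2) fun _ => 0 where
  poly₁ := (IsPolyFun.run A τ one_pos.le le_rfl one_pos.le).1.shift τ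
  poly₂ := (IsPolyFun.run A τ one_pos.le le_rfl one_pos.le).2.2.shift τ
  poly₃ := .const 0
  fst n := by rw [(run_two_mul A n τ).1, hu]; ring
  snd n := by rw [(run_two_mul A n τ).2.1, hu, hu]; ring

/-- Eliminate f(n+1) from the expressions for f(n+τ) and f(n+2τ) in f(n) and f(n+1). The factor in
front of f(n) becomes a determinant. Multiplying by the coefficient u of f(n+1) once more puts u²
into p₂ and u(n)u(n+τ) into q₁, which fixes their ultimate signs. -/
theorem isDecimation_run (A : RecData) (τ : ℕ) : IsDecimation A τ
    (fun n => (run A n τ (0, 1, 1)).1 * (run A n τ (1, 0, 1)).2.2 * (run A n (2 * τ) (0, 1, 1)).1)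
    (fun n => (run A n τ (0, 1, 1)).1 * (run A n τ (0, 1, 1)).1 * (run A n (2 * τ) (1, 0, 1)).2.2)
    (fun n => (run A n τ (0, 1, 1)).1 * (run A (n + τ) τ (0, 1, 1)).1 * runDet A n τ) := by
  have h1 := fun k => IsPolyFun.run A k (v := (1, 0, 1)) one_pos.le le_rfl one_pos.le
  have h2 := fun k => IsPolyFun.run A k (v := (0, 1, 1)) le_rfl one_pos.le one_pos.le
  refine ⟨((h2 τ).1.mul (h1 τ).2.2).mul (h2 _).1, ((h2 τ).1.mul (h2 τ).1).mul (h1 _).2.2,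
    ((h2 τ).1.mul ((h2 τ).1.shift τ)).mul
      (((h1 τ).1.mul (h2 τ).2.1).sub ((h2 τ).1.mul (h1 τ).2.1)), fun n => ?_, fun n => ?_⟩
  · rw [(run_two_mul A n τ).1, (run_two_mul A n τ).2.1, (run_two_mul A n τ).2.2, runDet]
    ring
  · rw [(run_two_mul A n τ).2.1, (run_two_mul A n τ).2.2]
    ring

variable {c : AlgInput} {P Q : RatFunc ℚ} {f : ℕ → ℚ} {s : List SignType}

theorem IsDecimation.exists_valid (h : IsDecimation A τ p₁ p₂ q₁) (hτ : 0 < τ)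
    (hf : A.Satisfies f) (hc : c.Represents P Q (f 0, f 1))
    (hlead : ∀ n, listEval A.lead n ≠ 0) (hleadpos : ∀ᶠ n in Filter.atTop, 0 < listEval A.lead n)
    (hP : ∀ n, listEval A.lead n * listEval c.1.1.1 n = listEval A.mid n * listEval c.1.1.2 n)
    (hQ : ∀ n, listEval A.lead n * listEval c.1.2.1 n = listEval A.low n * listEval c.1.2.2 n)
    (hp₂ : ∀ᶠ n in Filter.atTop, 0 < p₂ n) {l₁ l₂ : List ℤ}
    (hl : ∀ᶠ n in Filter.atTop, 0 < listEval l₁ n ∧ 0 < listEval l₂ n ∧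
      0 ≤ listEval l₂ (n + τ) * p₁ n - listEval l₁ (n + τ) * p₂ n ∧
      0 ≤ (listEval l₂ (n + τ) * p₁ n - listEval l₁ (n + τ) * p₂ n) * listEval l₁ n -
        listEval l₂ (n + τ) * listEval l₂ n * q₁ n ∧
      0 < (listEval l₂ n * f (n + τ) - listEval l₁ n * f n) * f n) :
    ∃ k : Certificate, k.Valid c := by
  have hL₁ := IsPolyFun.listEval l₁
  have hL₂ := IsPolyFun.listEval l₂
  have hS := ((hL₂.shift τ).mul h.poly₁).sub ((hL₁.shift τ).mul h.poly₂)
  obtain ⟨x, hx⟩ := hS.exists_list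
  obtain ⟨y, hy⟩ := ((hS.mul hL₁).sub (((hL₂.shift τ).mul hL₂).mul h.poly₃)).exists_list
  obtain ⟨z, hz⟩ := (hL₂.mul h.poly₂).exists_list
  refine Certificate.exists_valid ((A, (l₁, l₂)), ((x, y, z), (τ, 0))) hτ hf hc hlead hleadpos
    hP hQ (hl.mono fun n h => h.1) (hl.mono fun n h => h.2.1)
    (hl.mono fun n h => h.2.2.1.trans_eq (hx n).symm)
    (hl.mono fun n h => h.2.2.2.1.trans_eq (hy n).symm)
    (hl.mp (hp₂.mono fun n h h' => (mul_pos h'.2.1 h).trans_eq (hz n).symm))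
    (.of_forall fun n => ?_) (.of_forall fun n => ?_) (hl.mono fun n h => h.2.2.2.2)
  · change listEval z n * listEval l₂ (n + τ) * (run A n (2 * τ) (1, 0, 1)).1 +
        listEval x n * listEval l₁ n * (run A n (2 * τ) (1, 0, 1)).2.2 * 1 =
      (listEval z n * listEval l₁ (n + τ) + listEval x n * listEval l₂ n) *
        (run A n τ (1, 0, 1)).1 * (run A (n + τ) τ (1, 0, 1)).2.2 +
        listEval y n * (run A n (2 * τ) (1, 0, 1)).2.2 * 1
    rw [hx, hy, hz]
    linear_combination listEval l₂ n * listEval l₂ (n + τ) * h.fst n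
  · change listEval z n * listEval l₂ (n + τ) * (run A n (2 * τ) (0, 1, 1)).1 +
        listEval x n * listEval l₁ n * (run A n (2 * τ) (0, 1, 1)).2.2 * 0 =
      (listEval z n * listEval l₁ (n + τ) + listEval x n * listEval l₂ n) *
        (run A n τ (0, 1, 1)).1 * (run A (n + τ) τ (0, 1, 1)).2.2 +
        listEval y n * (run A n (2 * τ) (0, 1, 1)).2.2 * 0
    rw [hx, hz, run_snd_snd_eq A (n + τ) τ]
    linear_combination listEval l₂ n * listEval l₂ (n + τ) * h.snd n

theorem eventually_forall_ge {p : ℕ → Prop} (h : ∀ᶠ n in Filter.atTop, p n) :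
    ∀ᶠ n in Filter.atTop, ∀ m, n ≤ m → p m := by
  obtain ⟨N, hN⟩ := Filter.eventually_atTop.1 h
  exact Filter.eventually_atTop.2 ⟨N, fun n hn m hm => hN m (hn.trans hm)⟩

/-- The ratio f(n+τ)/f(n) is a positive rational function, and half of it serves as the slope. -/
theorem eventually_slope_of_eq_zero (hu : ∀ n, (run A n τ (0, 1, 1)).1 = 0) (hf : A.Satisfies f)
    (hleadpos : ∀ᶠ n in Filter.atTop, 0 < listEval A.lead n)
    (hpos : ∀ᶠ n in Filter.atTop, 0 < f (n + τ) * f n) :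
    ∃ l₁ l₂ : List ℤ, ∀ᶠ n in Filter.atTop, 0 < listEval l₁ n ∧ 0 < listEval l₂ n ∧
      0 ≤ listEval l₂ (n + τ) * (run A (n + τ) τ (1, 0, 1)).1 -
        listEval l₁ (n + τ) * (run A (n + τ) τ (1, 0, 1)).2.2 ∧
      0 ≤ (listEval l₂ (n + τ) * (run A (n + τ) τ (1, 0, 1)).1 -
        listEval l₁ (n + τ) * (run A (n + τ) τ (1, 0, 1)).2.2) * listEval l₁ n -
        listEval l₂ (n + τ) * listEval l₂ n * 0 ∧
      0 < (listEval l₂ n * f (n + τ) - listEval l₁ n * f n) * f n := by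
  have h1 := IsPolyFun.run A τ (v := (1, 0, 1)) one_pos.le le_rfl one_pos.le
  obtain ⟨l₁, h₁⟩ := h1.1.exists_list
  obtain ⟨l₂, h₂⟩ := ((IsPolyFun.const 2).mul h1.2.2).exists_list
  have key : ∀ᶠ n in Filter.atTop, 0 < (run A n τ (1, 0, 1)).1 ∧ 0 < (run A n τ (1, 0, 1)).2.2 ∧
      0 < ((run A n τ (1, 0, 1)).1 : ℚ) * f n * f n ∧
      ((run A n τ (1, 0, 1)).2.2 : ℚ) * f (n + τ) = (run A n τ (1, 0, 1)).1 * f n := by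
    filter_upwards [eventually_forall_ge hleadpos, hpos] with n hn hn'
    have h2 := (hf.run_basis n τ).1
    rw [hu, Int.cast_zero, zero_mul, add_zero] at h2
    have h3 := run_pos (k := τ) hn
    have h3' : (0 : ℚ) < (run A n τ (1, 0, 1)).2.2 := by exact_mod_cast h3
    have h4 : 0 < ((run A n τ (1, 0, 1)).1 : ℚ) * f n * f n := by
      rw [← h2, mul_assoc]
      exact mul_pos h3' hn'
    refine ⟨?_, h3, h4, h2⟩
    rw [mul_assoc] at h4
    exact_mod_cast pos_of_mul_pos_left h4 (mul_self_nonneg _)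
  refine ⟨l₁, l₂, ?_⟩
  filter_upwards [key, (Filter.tendsto_add_atTop_nat τ).eventually key] with n hn hn'
  rw [h₁, h₂, h₁, h₂]
  have h3 := mul_pos hn'.1 hn'.2.1
  refine ⟨hn.1, mul_pos two_pos hn.2.1, by linarith, ?_, ?_⟩
  · rw [mul_zero, sub_zero]
    exact mul_nonneg (by linarith) hn.1.le
  · push_cast
    linear_combination hn.2.2.1 - 2 * f n * hn.2.2.2

theorem eventually_slope_of_ne_zero (hτ : 0 < τ) (hu : ∀ᶠ n in Filter.atTop,
      0 < (run A n τ (0, 1, 1)).1 * (run A (n + τ) τ (0, 1, 1)).1)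
    (hA : ∀ g, IsHolonomic P Q g → A.Satisfies g) (hf : IsHolonomic P Q f)
    (hQ0 : NoZerosOrPoles Q) (hs : HasStableUltimateSign P Q f s)
    (hleadpos : ∀ᶠ n in Filter.atTop, 0 < listEval A.lead n)
    (hpos : ∀ᶠ n in Filter.atTop, 0 < f (n + τ) * f n)
    (h : IsDecimation A τ p₁ p₂ q₁) (hp₂ : ∀ᶠ n in Filter.atTop, 0 < p₂ n)
    (hq₁ : ∀ᶠ n in Filter.atTop, 0 < q₁ n) :
    ∃ l₁ l₂ : List ℤ, ∀ᶠ n in Filter.atTop, 0 < listEval l₁ n ∧ 0 < listEval l₂ n ∧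
      0 ≤ listEval l₂ (n + τ) * p₁ n - listEval l₁ (n + τ) * p₂ n ∧
      0 ≤ (listEval l₂ (n + τ) * p₁ n - listEval l₁ (n + τ) * p₂ n) * listEval l₁ n -
        listEval l₂ (n + τ) * listEval l₂ n * q₁ n ∧
      0 < (listEval l₂ n * f (n + τ) - listEval l₁ n * f n) * f n := by
  have hp₁ : ∀ᶠ n in Filter.atTop, 0 < p₁ n := by
    filter_upwards [hp₂, hq₁, hpos, (Filter.tendsto_add_atTop_nat τ).eventually hpos,
      eventually_forall_ge hleadpos] with n h1 h2 h3 h4 h5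
    have h6 := h.recurrence (hA f hf) h5
    rw [add_assoc, ← two_mul] at h4
    have h1' : (0 : ℚ) < p₂ n := by exact_mod_cast h1
    have h2' : (0 : ℚ) < q₁ n := by exact_mod_cast h2
    -- Multiplying the recurrence by f(n+τ) gives p₁ f(n+τ)² = p₂ f(n+2τ) f(n+τ) + q₁ f(n) f(n+τ),
    -- with both terms positive.
    have h7 : (0 : ℚ) < p₁ n * (f (n + τ) * f (n + τ)) := by
      linear_combination mul_pos h1' h4 + mul_pos h2' h3 + f (n + τ) * h6
    exact_mod_cast pos_of_mul_pos_left h7 (mul_self_nonneg _)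
  obtain ⟨n₀, hn₀⟩ := Filter.eventually_atTop.1
    (((hp₁.and hp₂).and (hpos.and (eventually_forall_ge hleadpos))).and hu)
  have hrec (g : ℕ → ℚ) (hg : A.Satisfies g) (n : ℕ) (hn : n₀ ≤ n) :
      (g (n + 2 * τ) : ℝ) = p₁ n / p₂ n * g (n + τ) - q₁ n / p₂ n * g n := by
    have h1 : ((p₂ n * g (n + 2 * τ) : ℚ) : ℝ) = (p₁ n * g (n + τ) - q₁ n * g n : ℚ) :=
      congrArg _ (h.recurrence hg (hn₀ n hn).1.2.2)
    have h2 : (p₂ n : ℝ) ≠ 0 := by exact_mod_cast (hn₀ n hn).1.1.2.ne'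
    push_cast at h1
    field_simp
    linear_combination h1
  obtain ⟨l₁, l₂, hl⟩ := exists_slope (f := fun n => (f n : ℝ)) hτ h.poly₁ h.poly₂ h.poly₃
    (fun n hn => (hn₀ n hn).1.1.1) (fun n hn => (hn₀ n hn).1.1.2)
    (fun n hn => by exact_mod_cast (hn₀ n hn).1.2.1) (hrec f (hA f hf)) fun n hn y => by
      have h1 : ((run A n τ (0, 1, 1)).1 : ℚ) ≠ 0 := by
        exact_mod_cast left_ne_zero_of_mul (hn₀ n hn).2.ne'
      have h2 : ((run A n τ (1, 0, 1)).2.2 : ℚ) ≠ 0 := by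
        exact_mod_cast (run_pos (hn₀ n hn).1.2.2).ne'
      -- Since f(n+τ) really involves f(n+1), a suitable value of g(n+1) produces any prescribed
      -- g(n+τ).
      obtain ⟨g, hg, hg1, hg2⟩ := exists_isHolonomic_eq (P := P) hQ0 n 1
        (((run A n τ (1, 0, 1)).2.2 * y - (run A n τ (1, 0, 1)).1) / (run A n τ (0, 1, 1)).1)
      obtain ⟨ε, hε, hεg⟩ := hs.exists_dominates hf hg
      refine ⟨fun n => g n, by simp [hg1], ?_, hrec g (hA g hg), ε, by exact_mod_cast hε,
        hεg.mono fun i hi => by simpa using (Rat.cast_le (K := ℝ)).2 hi⟩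
      have h3 := ((hA g hg).run_basis n τ).1
      rw [hg1, hg2, mul_div_cancel₀ _ h1] at h3
      have h4 : g (n + τ) = y := mul_left_cancel₀ h2 (by linear_combination h3)
      exact congrArg _ h4
  exact ⟨l₁, l₂, hl.mono fun n hn =>
    ⟨hn.1, hn.2.1, hn.2.2.1, hn.2.2.2.1, by exact_mod_cast hn.2.2.2.2⟩⟩

theorem HasStableUltimateSign.exists_valid (hs : HasStableUltimateSign P Q f s)
    (hc : c.Represents P Q (f 0, f 1)) (hP : NoZerosOrPoles P) (hQ : NoZerosOrPoles Q)
    (hf : IsHolonomic P Q f) : ∃ k : Certificate, k.Valid c := by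
  obtain ⟨A, hlead, hleadpos, h1, h2, hlow⟩ := hc.exists_recData hP hQ
  have hA : ∀ g, IsHolonomic P Q g → A.Satisfies g := fun g hg => hg.satisfies hc hP hQ h1 h2
  have hlen : 0 < s.length := List.length_pos_iff.2 hs.1.choose_spec.1
  -- Doubling the length of the sign word makes the step even, so that the determinant is ultimately
  -- positive.
  obtain ⟨τ, hτs⟩ : ∃ τ, τ = 2 * s.length := ⟨_, rfl⟩
  have hτ : 0 < τ := by omega
  have hpos := hs.eventually_mul_pos hf hQ 2
  rw [← hτs] at hpos
  have hdet : ∀ᶠ n in Filter.atTop, 0 < runDet A n τ := by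
    rw [hτs]
    exact eventually_runDet_pos hleadpos hlow _
  have hδ : ∀ k, ∀ᶠ n in Filter.atTop, 0 < (run A n k (1, 0, 1)).2.2 := fun k =>
    (eventually_forall_ge hleadpos).mono fun n hn => run_pos hn
  have hu := (IsPolyFun.run A τ (v := (0, 1, 1)) le_rfl one_pos.le one_pos.le).1.trichotomy
  by_cases hu0 : ∀ n, (run A n τ (0, 1, 1)).1 = 0
  · obtain ⟨l₁, l₂, hl⟩ := eventually_slope_of_eq_zero hu0 (hA f hf) hleadpos hpos
    exact (isDecimation_of_eq_zero hu0).exists_valid hτ (hA f hf) hc hlead hleadpos h1 h2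
      ((Filter.tendsto_add_atTop_nat τ).eventually (hδ τ)) hl
  · have hu' : ∀ᶠ n in Filter.atTop,
        0 < (run A n τ (0, 1, 1)).1 * (run A (n + τ) τ (0, 1, 1)).1 := by
      rcases hu.resolve_left hu0 with h | h
      · filter_upwards [h, (Filter.tendsto_add_atTop_nat τ).eventually h] with n h1 h2
        exact mul_pos h1 h2
      · filter_upwards [h, (Filter.tendsto_add_atTop_nat τ).eventually h] with n h1 h2
        exact mul_pos_of_neg_of_neg h1 h2
    have hp₂ : ∀ᶠ n in Filter.atTop, 0 < (run A n τ (0, 1, 1)).1 * (run A n τ (0, 1, 1)).1 *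
        (run A n (2 * τ) (1, 0, 1)).2.2 := by
      filter_upwards [hu', hδ (2 * τ)] with n h1 h2
      exact mul_pos (mul_self_pos.2 (left_ne_zero_of_mul h1.ne')) h2
    obtain ⟨l₁, l₂, hl⟩ := eventually_slope_of_ne_zero hτ hu' hA hf hQ hs hleadpos hpos
      (isDecimation_run A τ) hp₂ (hu'.mp (hdet.mono fun n h1 h2 => mul_pos h2 h1))
    exact (isDecimation_run A τ).exists_valid hτ (hA f hf) hc hlead hleadpos h1 h2 hp₂ hl

end Decimated

theorem mainTheorem4 :
    ∃ A : AlgInput →. ℕ, Partrec A ∧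
      ∀ P Q : RatFunc ℚ, NoZerosOrPoles P → NoZerosOrPoles Q →
      ∀ f : ℕ → ℚ, IsHolonomic P Q f →
      ∀ c : AlgInput, AlgInput.Represents c P Q (f 0, f 1) →
        ((A c).Dom ↔ ∃ s : List SignType, HasStableUltimateSign P Q f s) ∧
        ∀ N ∈ A c, ∃ s : List SignType,
          HasStableUltimateSign P Q f s ∧ HasUltimateSignAt f s N := by
  refine ⟨searchCertificate, partrec_searchCertificate, fun P Q hP hQ f hf c hc => ?_⟩
  have hsound : ∀ N ∈ searchCertificate c, ∃ s : List SignType,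
      HasStableUltimateSign P Q f s ∧ HasUltimateSignAt f s N := by
    intro N hN
    obtain ⟨k, hk, rfl⟩ := mem_searchCertificate hN
    exact ⟨_, hk.hasStableUltimateSign hc hP hQ hf⟩
  refine ⟨⟨fun h => ?_, fun ⟨s, hs⟩ => ?_⟩, hsound⟩
  · obtain ⟨s, hs, -⟩ := hsound _ (Part.get_mem h)
    exact ⟨s, hs⟩
  · obtain ⟨k, hk⟩ := hs.exists_valid hc hP hQ hf
    exact searchCertificate_dom hk
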